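/- **Setting.** Fix integers $K,K'\ge 1$ and $L\ge 0$, vectors $\alpha\in(0,1]^K$, $\beta\in(0,1]^{K'}$ with $\sum_k\alpha_k=\sum_{k'}\beta_{k'}=1$, a ratio $\gamma\in(0,1)$ and a matrix $R=(r_{kk'})\in[0,1]^{K\times K'}$, none of them depending on $N$, and a function $\omega=\omega(N)$ with $\omega\to\infty$ and $\omega=o(N)$. For every $N$ such that the following sizes are integers, let $\mathcal U$ be a set of $N$ users partitioned into classes $C_1,\dots,C_K$ with $|C_k|=\alpha_kN$, and $\mathcal F$ a set of $F=\gamma N$ items partitioned into classes $D_1,\dots,D_{K'}$ with $|D_{k'}|=\beta_{k'}F$. Write $k(u)$ and $k'(i)$ for the class of user $u$ and of item $i$. The rating matrix $S\in\{0,1\}^{N\times F}$ has independent entries, $S_{ui}$ being Bernoulli with parameter $p\,r_{k(u)k'(i)}$, $p=\omega/N$ (consider only $N$ for which these parameters lie in $[0,1]$, which holds for all large $N$). Let $G=R\,\mathrm{diag}(\beta)\,R^{\top}\,\mathrm{diag}(\alpha)\in\mathbb R^{K\times K}$, and $\|y\|_\alpha=\big(\sum_k\alpha_ky_k^2\big)^{1/2}$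 for $y\in\mathbb R^K$. All eigenvalues of $G$ are real; list them with multiplicity as $\lambda_1\ge\dots\ge\lambda_K$. Assume: * (D1) $L\le \operatorname{rank}(G)$. * (D2) The $L$ largest eigenvalues are distinct: $\lambda_1>\dots>\lambda_L$, and also $\lambda_L>\lambda_{L+1}$ if $1\le L<K$. * (D3) For eigenvectors $g_1,\dots,g_L$ of $G$ for $\lambda_1,\dots,\lambda_L$ with $\|g_\ell\|_\alpha=1$, the vectors $\chi_k=(g_1(k),\dots,g_L(k))\in\mathbb R^L$, $1\le k\le K$, are pairwise distinct. * (D4) There is a constant $C>0$ with $\omega\ge C\log N$ for all large $N$. Let $x_1,\dots,x_L\in\mathbb R^N$ be orthonormal left singular vectors of $S$ corresponding to its $L$ largest singular values, that is, the first $L$ columns of $X$ in a singular value decomposition $S=X\Sigma Y$ with $X\in\mathbb R^{N\times F}$ having orthonormal columns, $Y\in\mathbb R^{F\times F}$ orthogonal and $\Sigma$ diagonal with nonnegative decreasing diagonal entries. **Theorem.** There are sequences $\varepsilon_N,\delta_N,\eta_N\to0$, depending only on $K,K',L,\alpha,\beta,\gamma,R,\omega$ and $(g_\ell)$, such that for every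 $N$ as above, with probability at least $1-\eta_N$ the following holds. For every such choice of $x_1,\dots,x_L$ there are signs $s_1,\dots,s_L\in\{-1,1\}$, common to all users, such that, with $z_u=(s_1x_1(u),\dots,s_Lx_L(u))\in\mathbb R^L$, at least $(1-\delta_N)N$ users $u$ satisfy $$\big\|\sqrt N\,z_u-\chi_{k(u)}\big\|_2\le\varepsilon_N .$$ In words: with probability $1-o(1)$, a fraction $1-o(1)$ of the users have, up to a common choice of signs of the singular vectors, a scaled profile within $o(1)$ of the vector characteristic of their class, and these vectors are distinct for distinct classes. -/

import Mathlib

open Filter Topology MeasureTheory ProbabilityTheory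
open scoped Matrix

namespace RatingModel

noncomputable section

/-- The `α`-norm `‖y‖_α = √(∑ₖ αₖ yₖ²)` of a vector. -/
def alphaNorm {K : ℕ} (α y : Fin K → ℝ) : ℝ :=
  Real.sqrt (∑ k, α k * y k ^ 2)

/-- The constant matrix `G = R diag(β) R' diag(α)`. -/
def affinityGram {K K' : ℕ} (R : Matrix (Fin K) (Fin K') ℝ) (α : Fin K → ℝ) (β : Fin K' → ℝ) :
    Matrix (Fin K) (Fin K) ℝ :=
  R * Matrix.diagonal β * Rᵀ * Matrix.diagonal α

/-- Counting eigenvalues with multiplicity, `lam 0 > lam 1 > ⋯` are the `L` largest eigenvalues of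
`G` and they are distinct: each of them is simple, and all the other eigenvalues of `G` are
strictly smaller. -/
structure AreLargestEigenvalues {K L : ℕ} (G : Matrix (Fin K) (Fin K) ℝ) (lam : Fin L → ℝ) :
    Prop where
  strictAnti : StrictAnti lam
  simple : ∀ l, G.charpoly.rootMultiplicity (lam l) = 1
  largest : ∀ ν, G.charpoly.IsRoot ν → (∃ l, ν = lam l) ∨ ∀ l, ν < lam l

/-- The class map `c` splits `Fin n` into classes of sizes exactly `a k * n`. -/
def HasClassFractions {n K : ℕ} (c : Fin n → Fin K) (a : Fin K → ℝ) : Prop :=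
  ∀ k, ((Finset.univ.filter fun u => c u = k).card : ℝ) = a k * n

/-- `S` is a random 0/1 matrix with independent Bernoulli entries of parameters `q u i`. -/
structure IsBernoulliMatrix {Ω : Type*} [MeasurableSpace Ω] (P : Measure Ω) {N F : ℕ}
    (S : Ω → Matrix (Fin N) (Fin F) ℝ) (q : Matrix (Fin N) (Fin F) ℝ) : Prop where
  zero_or_one : ∀ w u i, S w u i = 0 ∨ S w u i = 1
  measurable : ∀ u i, Measurable fun w => S w u i
  indep : iIndepFun (fun (e : Fin N × Fin F) w => S w e.1 e.2) P
  prob : ∀ u i, P.real {w | S w u i = 1} = q u i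

/-- `A = X diag(σ) Y` is a (thin) singular value decomposition of `A`, with the singular values in
decreasing order: the columns of `X` are orthonormal left singular vectors, the rows of the square
orthogonal matrix `Y` are right singular vectors. -/
structure IsSVD {N F : ℕ} (A : Matrix (Fin N) (Fin F) ℝ) (X : Matrix (Fin N) (Fin F) ℝ)
    (σ : Fin F → ℝ) (Y : Matrix (Fin F) (Fin F) ℝ) : Prop where
  eq_mul : A = X * Matrix.diagonal σ * Y
  left_orth : Xᵀ * X = 1
  right_orth : Y * Yᵀ = 1
  nonneg : ∀ j, 0 ≤ σ j
  antitone : Antitone σ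

/-- `x 0, …, x (L-1)` are normalised left singular vectors of `A` corresponding to its `L` largest
singular values: the first `L` columns of the left factor in some singular value decomposition. -/
def AreTopLeftSingularVectors {N F L : ℕ} (A : Matrix (Fin N) (Fin F) ℝ)
    (x : Fin L → Fin N → ℝ) : Prop :=
  ∃ (X : Matrix (Fin N) (Fin F) ℝ) (σ : Fin F → ℝ) (Y : Matrix (Fin F) (Fin F) ℝ),
    IsSVD A X σ Y ∧ ∃ h : L ≤ F, ∀ l u, x l u = X u (Fin.castLE h l)

/-- The row `(v_1(j), …, v_L(j))` of `j`-th coordinates, as a point of Euclidean space. For singular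
vectors `v` this is the profile `z_j`; for the eigenvectors of `G` it is the class vector `χ_j`. -/
def coordRow {ι : Type*} {L : ℕ} (v : Fin L → ι → ℝ) (j : ι) : EuclideanSpace ℝ (Fin L) :=
  WithLp.toLp 2 fun l => v l j

end

end RatingModel

/-! Let `M` be the mean of `S`. It is constant on pairs of classes, so its quadratic form `y ↦
‖Mᵀy‖²` is diagonalised by vectors depending on the class only: for the top `L` of them the entries
are `± g l (k(u)) / √N` and the eigenvalues are `ω² γ lam l`. The rank condition makes the `lam l`
positive and simplicity separates them, so there is a spectral gap of order `ω²`. Since `‖M‖ ≤ ω`, a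
noise with `‖S - M‖ ≤ κω` moves the form by at most `3κω²`; hence `‖S - M‖ = o(ω)` forces each top
singular vector to be `o(1)`-close, up to sign, to a class vector. Markov's inequality turns this
mean square closeness into closeness at all but `o(N)` users.

The noise bound only has to be `o(ω)`, not the optimal `O(√ω)`, and follows from deterministic
properties (`IsQuasirandom`) that hold with high probability by Chernoff and union bounds. A unit
vector is split into light coordinates, of size at most `B/√N`, and heavy ones. On light coordinates
the bilinear form is controlled by its values at sign vectors. The heavy coordinates are few, and
all small blocks of `S` are sparse, so the entries can be distributed between rows and columns with
each receiving little weight (`exists_orientation`); Schur's test then applies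
(`bilinear_le_of_small_support`). The bound `ω ≥ C log N` is what controls the row and column sums
and the small blocks.

The spectral side is Ky Fan's inequality with a quantitative loss (`gap_mul_one_sub_sq_inner_le`),
and `exists_signs_of_noise_le` joins the two sides. -/

namespace RatingModel

/-! ### Chernoff and union bounds for Bernoulli matrices. -/

section Concentration

variable {Ω : Type*} [MeasurableSpace Ω] {P : Measure Ω} {N F : ℕ}
  {S : Ω → Matrix (Fin N) (Fin F) ℝ} {q : Matrix (Fin N) (Fin F) ℝ}

lemma IsBernoulliMatrix.integral_eq (h : IsBernoulliMatrix P S q) (u : Fin N) (i : Fin F) :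
    ∫ w, S w u i ∂P = q u i := by
  have hS : (fun w => S w u i) = {w | S w u i = 1}.indicator 1 := by
    ext w
    rcases h.zero_or_one w u i with h | h <;> simp [Set.indicator, h]
  have hm : MeasurableSet {w | S w u i = 1} := h.measurable u i (measurableSet_singleton 1)
  rw [hS, integral_indicator_one hm]
  exact h.prob u i

/-- The exponential is affine on `{0, 1}`. The factor `1` is the argument of `mgf`: the Chernoff
parameter is absorbed into the coefficient `c`. -/
lemma IsBernoulliMatrix.exp_mul_eq (h : IsBernoulliMatrix P S q) (c : ℝ) (u : Fin N) (i : Fin F)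
    (w : Ω) : Real.exp (1 * (c * S w u i)) = 1 + (Real.exp c - 1) * S w u i := by
  rcases h.zero_or_one w u i with h | h <;> simp [h]

variable [IsProbabilityMeasure P]

lemma IsBernoulliMatrix.integrable (h : IsBernoulliMatrix P S q) (u : Fin N) (i : Fin F) :
    Integrable (fun w => S w u i) P := by
  refine Integrable.of_mem_Icc 0 1 (h.measurable u i).aemeasurable (ae_of_all _ fun w => ?_)
  rcases h.zero_or_one w u i with h | h <;> simp [h]

lemma IsBernoulliMatrix.integrable_exp_mul (h : IsBernoulliMatrix P S q) (c : ℝ) (u : Fin N)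
    (i : Fin F) : Integrable (fun w => Real.exp (1 * (c * S w u i))) P := by
  simp_rw [h.exp_mul_eq]
  exact (integrable_const _).add ((h.integrable u i).const_mul _)

lemma IsBernoulliMatrix.mgf_entry (h : IsBernoulliMatrix P S q) (c : ℝ) (u : Fin N) (i : Fin F) :
    mgf (fun w => c * S w u i) P 1 = 1 + (Real.exp c - 1) * q u i := by
  unfold mgf
  simp_rw [h.exp_mul_eq]
  rw [integral_add (integrable_const _) ((h.integrable u i).const_mul _), integral_const_mul,
    h.integral_eq]
  simp

/-- Chernoff bound for a linear statistic of a Bernoulli matrix. -/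
lemma IsBernoulliMatrix.tail_le (h : IsBernoulliMatrix P S q) (c : Matrix (Fin N) (Fin F) ℝ)
    (τ : ℝ) : P.real {w | τ ≤ ∑ u, ∑ i, c u i * S w u i} ≤
      Real.exp (∑ u, ∑ i, q u i * (Real.exp (c u i) - 1) - τ) := by
  set X : Fin N × Fin F → Ω → ℝ := fun e w => c e.1 e.2 * S w e.1 e.2 with hX
  have hind : iIndepFun X P :=
    h.indep.comp (fun e x => c e.1 e.2 * x) (fun e => measurable_const_mul _)
  have hmeas : ∀ e, Measurable (X e) := fun e => (h.measurable e.1 e.2).const_mul _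
  have hint : Integrable (fun w => Real.exp (1 * (∑ e, X e) w)) P :=
    hind.integrable_exp_mul_sum hmeas fun e _ => h.integrable_exp_mul _ _ _
  have h1 := measure_ge_le_exp_mul_mgf (μ := P) (X := ∑ e, X e) τ zero_le_one hint
  have hset : {w | τ ≤ ∑ u, ∑ i, c u i * S w u i} = {w | τ ≤ (∑ e, X e) w} := by
    ext w
    simp [hX, Finset.sum_apply, Fintype.sum_prod_type]
  rw [hset]
  refine h1.trans ?_
  rw [hind.mgf_sum hmeas, sub_eq_neg_add, Real.exp_add, neg_one_mul]
  refine mul_le_mul_of_nonneg_left ?_ (Real.exp_nonneg _)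
  rw [← Fintype.sum_prod_type (f := fun e : Fin N × Fin F => q e.1 e.2 * (Real.exp (c e.1 e.2) - 1)),
    Real.exp_sum]
  refine Finset.prod_le_prod (fun e _ => mgf_nonneg) fun e _ => ?_
  rw [hX, h.mgf_entry, mul_comm, add_comm]
  exact Real.add_one_le_exp _

lemma sum_sum_le_of_entries {p : ℝ} (hF : F ≤ N) {ω : ℝ} (hω : 0 ≤ ω) (hp : p = ω / N)
    {f : Matrix (Fin N) (Fin F) ℝ} {t : ℝ} (ht : 0 ≤ t) (hf : ∀ u i, f u i ≤ p * t) :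
    ∑ u, ∑ i, f u i ≤ ω * N * t := by
  have h1 : ∑ u, ∑ i, f u i ≤ ∑ _u : Fin N, ∑ _i : Fin F, p * t :=
    Finset.sum_le_sum fun u _ => Finset.sum_le_sum fun i _ => hf u i
  refine h1.trans ?_
  simp only [Finset.sum_const, Finset.card_univ, Fintype.card_fin, nsmul_eq_mul]
  rcases Nat.eq_zero_or_pos N with rfl | hN
  · simp
  have hN' : (0 : ℝ) < N := by exact_mod_cast hN
  have hF' : (F : ℝ) ≤ N := by exact_mod_cast hF
  calc (N : ℝ) * (F * (p * t)) = F * (ω * t) := by rw [hp]; field_simp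
    _ ≤ N * (ω * t) := mul_le_mul_of_nonneg_right hF' (by positivity)
    _ = _ := by ring

/-- Tail bound for the bilinear form of the noise at a pair of sign vectors. -/
lemma IsBernoulliMatrix.sign_tail_le (h : IsBernoulliMatrix P S q) (hF : F ≤ N) {ω : ℝ}
    (hω : 0 ≤ ω) (hq0 : ∀ u i, 0 ≤ q u i) (hq : ∀ u i, q u i ≤ ω / N) {ε : ℝ} (hε : 0 < ε)
    (hε1 : ε ≤ 1) (a : Fin N → ℤˣ) (b : Fin F → ℤˣ) :
    P.real {w | ε * ω * N ≤ ∑ u, ∑ i, (a u : ℤ) * ((S w u i - q u i) * (b i : ℤ))} ≤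
      Real.exp (-(ε ^ 2 / 4 * ω * N)) := by
  -- With scale `s` in place of `ε / 2`, the exponent is at most `(s² - sε) ω N`, because `exp c - 1
  -- - c ≤ c²` for `|c| ≤ 1`. The choice `s = ε / 2` is optimal and gives `-ε² / 4`.
  set c : Matrix (Fin N) (Fin F) ℝ := fun u i => ε / 2 * ((a u : ℤ) * (b i : ℤ)) with hc
  have habs : ∀ u i, c u i ^ 2 = (ε / 2) ^ 2 := by
    intro u i
    rcases Int.units_eq_one_or (a u) with h | h <;> rcases Int.units_eq_one_or (b i) with h' | h' <;>
      simp [hc, h, h']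
  have habs1 : ∀ u i, |c u i| ≤ 1 := by
    intro u i
    rw [← sq_le_one_iff_abs_le_one, habs]
    nlinarith
  have h1 := h.tail_le c (ε / 2 * (ε * ω * N) + ∑ u, ∑ i, q u i * c u i)
  have hset : {w | ε * ω * N ≤ ∑ u, ∑ i, (a u : ℤ) * ((S w u i - q u i) * (b i : ℤ))} =
      {w | ε / 2 * (ε * ω * N) + ∑ u, ∑ i, q u i * c u i ≤ ∑ u, ∑ i, c u i * S w u i} := by
    ext w
    have : ∑ u, ∑ i, c u i * S w u i - ∑ u, ∑ i, q u i * c u i =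
        ε / 2 * ∑ u, ∑ i, ((a u : ℤ) : ℝ) * ((S w u i - q u i) * (b i : ℤ)) := by
      simp only [Finset.mul_sum, ← Finset.sum_sub_distrib]
      refine Finset.sum_congr rfl fun u _ => Finset.sum_congr rfl fun i _ => ?_
      simp only [hc]; ring
    simp only [Set.mem_ofPred_eq]
    rw [← le_sub_iff_add_le, this, mul_le_mul_iff_right₀ (by positivity)]
  rw [hset]
  refine h1.trans (Real.exp_le_exp.2 ?_)
  have h2 : ∑ u, ∑ i, q u i * (Real.exp (c u i) - 1) - ∑ u, ∑ i, q u i * c u i ≤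
      ω * N * (ε / 2) ^ 2 := by
    simp only [← Finset.sum_sub_distrib]
    refine sum_sum_le_of_entries hF hω rfl (by positivity) fun u i => ?_
    have h3 := (abs_le.1 (Real.abs_exp_sub_one_sub_id_le (habs1 u i))).2
    rw [habs] at h3
    calc q u i * (Real.exp (c u i) - 1) - q u i * c u i
        = q u i * (Real.exp (c u i) - 1 - c u i) := by ring
      _ ≤ q u i * (ε / 2) ^ 2 := mul_le_mul_of_nonneg_left h3 (hq0 u i)
      _ ≤ _ := mul_le_mul_of_nonneg_right (hq u i) (by positivity)
  nlinarith

/-- Uniform bound on the bilinear form of the noise over all pairs of sign vectors. -/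
lemma IsBernoulliMatrix.exists_sign_le (h : IsBernoulliMatrix P S q) (hF : F ≤ N) {ω : ℝ}
    (hω : 0 ≤ ω) (hq0 : ∀ u i, 0 ≤ q u i) (hq : ∀ u i, q u i ≤ ω / N) {ε : ℝ} (hε : 0 < ε)
    (hε1 : ε ≤ 1) :
    P.real {w | ∃ (a : Fin N → ℤˣ) (b : Fin F → ℤˣ),
      ε * ω * N ≤ ∑ u, ∑ i, (a u : ℤ) * ((S w u i - q u i) * (b i : ℤ))} ≤
      4 ^ N * Real.exp (-(ε ^ 2 / 4 * ω * N)) := by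
  have hset : {w | ∃ (a : Fin N → ℤˣ) (b : Fin F → ℤˣ),
      ε * ω * N ≤ ∑ u, ∑ i, (a u : ℤ) * ((S w u i - q u i) * (b i : ℤ))} =
      ⋃ ab : (Fin N → ℤˣ) × (Fin F → ℤˣ), {w | ε * ω * N ≤
        ∑ u, ∑ i, (ab.1 u : ℤ) * ((S w u i - q u i) * (ab.2 i : ℤ))} := by
    ext w; simp
  rw [hset]
  refine (measureReal_iUnion_fintype_le _).trans ?_
  refine (Finset.sum_le_sum fun ab _ => h.sign_tail_le hF hω hq0 hq hε hε1 ab.1 ab.2).trans ?_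
  rw [Finset.sum_const, nsmul_eq_mul]
  refine mul_le_mul_of_nonneg_right ?_ (Real.exp_nonneg _)
  simp only [Finset.card_univ, Fintype.card_prod, Fintype.card_fun, Fintype.card_units_int,
    Fintype.card_fin]
  push_cast
  calc (2 : ℝ) ^ N * 2 ^ F ≤ 2 ^ N * 2 ^ N := by
        gcongr
        norm_num
    _ = 4 ^ N := by rw [← mul_pow]; norm_num

/-- The mean row sum is at most `ω` and `e - 1 ≤ 2`, whence the `2` in the exponent. -/
lemma IsBernoulliMatrix.row_sum_tail_le (h : IsBernoulliMatrix P S q) (hF : F ≤ N) {ω : ℝ}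
    (hω : 0 ≤ ω) (hq : ∀ u i, q u i ≤ ω / N) (D : ℝ) (u : Fin N) :
    P.real {w | D * ω ≤ ∑ i, S w u i} ≤ Real.exp (-((D - 2) * ω)) := by
  have h1 := h.tail_le (fun u' _ => if u' = u then 1 else 0) (D * ω)
  have hset : ∀ w, ∑ u', ∑ i, (if u' = u then (1 : ℝ) else 0) * S w u' i = ∑ i, S w u i := by
    intro w
    rw [Finset.sum_eq_single u] <;> simp +contextual
  simp only [hset] at h1
  refine h1.trans (Real.exp_le_exp.2 ?_)
  have h2 : ∑ u', ∑ i, q u' i * (Real.exp (if u' = u then 1 else 0) - 1) =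
      ∑ i, q u i * (Real.exp 1 - 1) := by
    rw [Finset.sum_eq_single u] <;> simp +contextual
  rw [h2]
  have he : Real.exp 1 - 1 ≤ 2 := by have := Real.exp_one_lt_d9; linarith
  have he0 : 0 ≤ Real.exp 1 - 1 := by have := Real.add_one_le_exp (1 : ℝ); linarith
  have h3 : ∑ i, q u i * (Real.exp 1 - 1) ≤ ∑ _i : Fin F, ω / N * 2 :=
    Finset.sum_le_sum fun i _ => mul_le_mul (hq u i) he he0 (by positivity)
  rw [Finset.sum_const, Finset.card_univ, Fintype.card_fin, nsmul_eq_mul] at h3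
  have h4 : (F : ℝ) * (ω / N * 2) ≤ 2 * ω := by
    have hN : (0 : ℝ) < N := by exact_mod_cast u.pos
    have hF' : (F : ℝ) ≤ N := by exact_mod_cast hF
    calc (F : ℝ) * (ω / N * 2) ≤ N * (ω / N * 2) := by gcongr
      _ = 2 * ω := by field_simp
  linarith

lemma IsBernoulliMatrix.col_sum_tail_le (h : IsBernoulliMatrix P S q) {ω : ℝ}
    (hω : 0 ≤ ω) (hq : ∀ u i, q u i ≤ ω / N) (D : ℝ) (i : Fin F) :
    P.real {w | D * ω ≤ ∑ u, S w u i} ≤ Real.exp (-((D - 2) * ω)) := by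
  have h1 := h.tail_le (fun _ i' => if i' = i then 1 else 0) (D * ω)
  have hset : ∀ w, ∑ u, ∑ i', (if i' = i then (1 : ℝ) else 0) * S w u i' = ∑ u, S w u i := by
    intro w
    simp
  simp only [hset] at h1
  refine h1.trans (Real.exp_le_exp.2 ?_)
  have h2 : ∑ u, ∑ i', q u i' * (Real.exp (if i' = i then 1 else 0) - 1) =
      ∑ u, q u i * (Real.exp 1 - 1) := by
    refine Finset.sum_congr rfl fun u _ => ?_
    rw [Finset.sum_eq_single i] <;> simp +contextual
  rw [h2]
  have he : Real.exp 1 - 1 ≤ 2 := by have := Real.exp_one_lt_d9; linarith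
  have he0 : 0 ≤ Real.exp 1 - 1 := by have := Real.add_one_le_exp (1 : ℝ); linarith
  have h3 : ∑ u, q u i * (Real.exp 1 - 1) ≤ ∑ _u : Fin N, ω / N * 2 :=
    Finset.sum_le_sum fun u _ => mul_le_mul (hq u i) he he0 (by positivity)
  rw [Finset.sum_const, Finset.card_univ, Fintype.card_fin, nsmul_eq_mul] at h3
  have h4 : (N : ℝ) * (ω / N * 2) ≤ 2 * ω := by
    rcases Nat.eq_zero_or_pos N with rfl | hN
    · simpa using hω
    have hN : (0 : ℝ) < N := by exact_mod_cast hN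
    exact le_of_eq (by field_simp)
  linarith

/-- The number of edges of a small subgraph is at most proportional to its number of vertices. -/
lemma IsBernoulliMatrix.block_sum_tail_le (h : IsBernoulliMatrix P S q) {ω : ℝ}
    (hω : 0 ≤ ω) (hq : ∀ u i, q u i ≤ ω / N) {δ t η : ℝ} (ht : 0 ≤ t)
    (hη : Real.exp t * η ≤ 1) (A : Finset (Fin N)) (T : Finset (Fin F))
    (hAT : (A.card + T.card : ℝ) ≤ η * N) :
    P.real {w | δ * ω * (A.card + T.card) ≤ ∑ u ∈ A, ∑ i ∈ T, S w u i} ≤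
      Real.exp (-((t * δ - 1) * ω)) ^ A.card * Real.exp (-((t * δ - 1) * ω)) ^ T.card := by
  set c : Matrix (Fin N) (Fin F) ℝ := fun u i => if u ∈ A then if i ∈ T then t else 0 else 0 with hc
  have h1 := h.tail_le c (t * (δ * ω * (A.card + T.card)))
  have hset : ∀ w, ∑ u, ∑ i, c u i * S w u i = t * ∑ u ∈ A, ∑ i ∈ T, S w u i := by
    intro w
    simp only [hc, ite_mul, zero_mul, Finset.mul_sum]
    rw [← Finset.sum_filter_add_sum_filter_not Finset.univ (· ∈ A)]
    rw [Finset.sum_eq_zero (s := {x | x ∉ A}) (by simp +contextual)]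
    simp only [Finset.filter_mem_eq_inter, Finset.univ_inter, add_zero]
    refine Finset.sum_congr rfl fun u hu => ?_
    simp [hu]
  have h2 : ∑ u, ∑ i, q u i * (Real.exp (c u i) - 1) =
      ∑ u ∈ A, ∑ i ∈ T, q u i * (Real.exp t - 1) := by
    rw [← Finset.sum_filter_add_sum_filter_not Finset.univ (· ∈ A)]
    rw [Finset.sum_eq_zero (s := {x | x ∉ A}) (by simp +contextual [hc])]
    simp only [Finset.filter_mem_eq_inter, Finset.univ_inter, add_zero]
    refine Finset.sum_congr rfl fun u hu => ?_
    rw [← Finset.sum_filter_add_sum_filter_not Finset.univ (· ∈ T)]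
    rw [Finset.sum_eq_zero (s := {x | x ∉ T}) (by simp +contextual [hc])]
    simp only [Finset.filter_mem_eq_inter, Finset.univ_inter, add_zero]
    refine Finset.sum_congr rfl fun i hi => ?_
    simp [hc, hu, hi]
  have hmono : P.real {w | δ * ω * (A.card + T.card) ≤ ∑ u ∈ A, ∑ i ∈ T, S w u i} ≤
      P.real {w | t * (δ * ω * (A.card + T.card)) ≤ ∑ u, ∑ i, c u i * S w u i} := by
    refine measureReal_mono fun w hw => ?_
    simp only [Set.mem_ofPred_eq, hset]
    exact mul_le_mul_of_nonneg_left hw ht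
  refine (hmono.trans h1).trans ?_
  rw [← pow_add, ← Real.exp_nat_mul, h2]
  refine Real.exp_le_exp.2 ?_
  have het : 0 ≤ Real.exp t - 1 := by have := Real.add_one_le_exp t; linarith
  have h3 : ∑ u ∈ A, ∑ i ∈ T, q u i * (Real.exp t - 1) ≤
      ∑ _u ∈ A, ∑ _i ∈ T, ω / N * (Real.exp t - 1) :=
    Finset.sum_le_sum fun u _ => Finset.sum_le_sum fun i _ =>
      mul_le_mul_of_nonneg_right (hq u i) het
  simp only [Finset.sum_const, nsmul_eq_mul] at h3
  rcases Nat.eq_zero_or_pos N with rfl | hN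
  · have hA : A = ∅ := Finset.eq_empty_of_isEmpty A
    subst hA
    have hT : T.card = 0 := by
      have : (T.card : ℝ) ≤ 0 := by simpa using hAT
      exact_mod_cast le_antisymm this (Nat.cast_nonneg _)
    simp [hT]
  have hN : (0 : ℝ) < N := by exact_mod_cast hN
  have hA0 : (0 : ℝ) ≤ A.card := Nat.cast_nonneg _
  have hT0 : (0 : ℝ) ≤ T.card := Nat.cast_nonneg _
  -- A small block has `|A||T| ≤ ηN(|A| + |T|)`, and `η ≤ exp (-t)` cancels the factor `exp t`: the
  -- mean costs at most `ω` per vertex, against a gain of `tδω` per vertex.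
  have h4 : (A.card : ℝ) * (T.card * (ω / N * (Real.exp t - 1))) ≤ ω * (A.card + T.card) := by
    have h5 : (A.card : ℝ) * T.card ≤ (η * N) * (A.card + T.card) := by nlinarith
    calc (A.card : ℝ) * (T.card * (ω / N * (Real.exp t - 1)))
        = (A.card * T.card) * (ω / N * (Real.exp t - 1)) := by ring
      _ ≤ ((η * N) * (A.card + T.card)) * (ω / N * (Real.exp t - 1)) :=
          mul_le_mul_of_nonneg_right h5 (by positivity)
      _ = ω * (A.card + T.card) * (Real.exp t * η - η) := by field_simp
      _ ≤ ω * (A.card + T.card) * 1 := by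
          refine mul_le_mul_of_nonneg_left ?_ (by positivity)
          have : 0 ≤ η := by
            by_contra hneg
            push Not at hneg
            nlinarith
          linarith
      _ = _ := by ring
  push_cast
  nlinarith

/-- Uniform bound on the number of edges of all small subgraphs. -/
lemma IsBernoulliMatrix.exists_dense_block_le (h : IsBernoulliMatrix P S q) (hF : F ≤ N) {ω : ℝ}
    (hω : 0 ≤ ω) (hq : ∀ u i, q u i ≤ ω / N) {δ t η : ℝ} (ht : 0 ≤ t)
    (hη : Real.exp t * η ≤ 1) :
    P.real {w | ∃ (A : Finset (Fin N)) (T : Finset (Fin F)), (A.card + T.card : ℝ) ≤ η * N ∧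
      δ * ω * (A.card + T.card) < ∑ u ∈ A, ∑ i ∈ T, S w u i} ≤
      Real.exp (2 * N * Real.exp (-((t * δ - 1) * ω))) - 1 := by
  set r := Real.exp (-((t * δ - 1) * ω)) with hr
  have hr0 : 0 ≤ r := Real.exp_nonneg _
  -- The empty pair would contribute `1` to the union bound; the strict inequality in the event
  -- excludes it. The remaining terms sum to `(1 + r) ^ (N + F) - 1` by the binomial theorem.
  set I : Finset (Finset (Fin N) × Finset (Fin F)) := Finset.univ.erase (∅, ∅) with hI
  set f : Finset (Fin N) × Finset (Fin F) → Set Ω := fun AT =>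
    {w | (AT.1.card + AT.2.card : ℝ) ≤ η * N ∧
      δ * ω * (AT.1.card + AT.2.card) ≤ ∑ u ∈ AT.1, ∑ i ∈ AT.2, S w u i} with hf
  have hsub : {w | ∃ (A : Finset (Fin N)) (T : Finset (Fin F)), (A.card + T.card : ℝ) ≤ η * N ∧
      δ * ω * (A.card + T.card) < ∑ u ∈ A, ∑ i ∈ T, S w u i} ⊆ ⋃ AT ∈ I, f AT := by
    rintro w ⟨A, T, h1, h2⟩
    simp only [Set.mem_iUnion]
    refine ⟨(A, T), ?_, h1, h2.le⟩
    simp only [hI, Finset.mem_erase, Finset.mem_univ, and_true, ne_eq, Prod.mk.injEq, not_and]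
    rintro rfl rfl
    simp at h2
  have hterm : ∀ AT, P.real (f AT) ≤ r ^ AT.1.card * r ^ AT.2.card := by
    intro AT
    by_cases hAT : (AT.1.card + AT.2.card : ℝ) ≤ η * N
    · refine (measureReal_mono ?_).trans (h.block_sum_tail_le hω hq (δ := δ) ht hη AT.1 AT.2 hAT)
      exact fun w hw => hw.2
    · have : f AT = ∅ := by
        ext w; simp [hf, hAT]
      rw [this]
      simpa using by positivity
  refine (measureReal_mono hsub (measure_ne_top P _)).trans
    ((measureReal_biUnion_finset_le _ _).trans ?_)
  refine (Finset.sum_le_sum fun AT _ => hterm AT).trans ?_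
  have hsum : ∑ AT ∈ I, r ^ AT.1.card * r ^ AT.2.card + 1 = (r + 1) ^ N * (r + 1) ^ F := by
    have h1 := Fintype.sum_pow_mul_eq_add_pow (Fin N) r 1
    have h2 := Fintype.sum_pow_mul_eq_add_pow (Fin F) r 1
    simp only [one_pow, mul_one, Fintype.card_fin] at h1 h2
    rw [← h1, ← h2, Finset.sum_mul_sum, ← Finset.sum_product', Finset.univ_product_univ, hI,
      ← Finset.sum_erase_add Finset.univ _ (Finset.mem_univ (∅, ∅))]
    simp
  rw [eq_sub_of_add_eq hsum, ← pow_add]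
  refine sub_le_sub_right ?_ 1
  calc (r + 1) ^ (N + F) ≤ (r + 1) ^ (2 * N) := pow_le_pow_right₀ (by linarith) (by omega)
    _ ≤ Real.exp r ^ (2 * N) := by gcongr; exact Real.add_one_le_exp r
    _ = _ := by rw [← Real.exp_nat_mul]; push_cast; ring_nf

end Concentration

/-! ### Quasirandomness holds with high probability. -/

/-- The regularity properties of a random Bernoulli matrix with mean `M` on which the spectral
bounds rest: a small noise in cut norm, bounded row and column sums, sparse small blocks. -/
structure IsQuasirandom {N F : ℕ} (A M : Matrix (Fin N) (Fin F) ℝ) (ω ε D δ η : ℝ) : Prop where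
  sign : ∀ (a : Fin N → ℤˣ) (b : Fin F → ℤˣ),
    ∑ u, ∑ i, (a u : ℤ) * ((A u i - M u i) * (b i : ℤ)) ≤ ε * ω * N
  row : ∀ u, ∑ i, A u i ≤ D * ω
  col : ∀ i, ∑ u, A u i ≤ D * ω
  block : ∀ (X : Finset (Fin N)) (T : Finset (Fin F)), (X.card + T.card : ℝ) ≤ η * N →
    ∑ u ∈ X, ∑ i ∈ T, A u i ≤ δ * ω * (X.card + T.card)

lemma IsBernoulliMatrix.not_isQuasirandom_le {Ω : Type*} [MeasurableSpace Ω] {P : Measure Ω}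
    [IsProbabilityMeasure P] {N F : ℕ} {S : Ω → Matrix (Fin N) (Fin F) ℝ}
    {q : Matrix (Fin N) (Fin F) ℝ} (h : IsBernoulliMatrix P S q) (hF : F ≤ N) {ω : ℝ}
    (hω : 0 ≤ ω) (hq0 : ∀ u i, 0 ≤ q u i) (hq : ∀ u i, q u i ≤ ω / N) {ε δ t η : ℝ} (hε : 0 < ε)
    (hε1 : ε ≤ 1) (ht : 0 ≤ t) (hη : Real.exp t * η ≤ 1) (D : ℝ) :
    P.real {w | ¬ IsQuasirandom (S w) q ω ε D δ η} ≤
      4 ^ N * Real.exp (-(ε ^ 2 / 4 * ω * N)) + 2 * N * Real.exp (-((D - 2) * ω)) +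
        (Real.exp (2 * N * Real.exp (-((t * δ - 1) * ω))) - 1) := by
  set B1 := {w | ∃ (a : Fin N → ℤˣ) (b : Fin F → ℤˣ),
      ε * ω * N ≤ ∑ u, ∑ i, (a u : ℤ) * ((S w u i - q u i) * (b i : ℤ))}
  set B2 : Set Ω := ⋃ u, {w | D * ω ≤ ∑ i, S w u i}
  set B3 : Set Ω := ⋃ i, {w | D * ω ≤ ∑ u, S w u i}
  set B4 := {w | ∃ (A : Finset (Fin N)) (T : Finset (Fin F)), (A.card + T.card : ℝ) ≤ η * N ∧
      δ * ω * (A.card + T.card) < ∑ u ∈ A, ∑ i ∈ T, S w u i}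
  have hsub : {w | ¬ IsQuasirandom (S w) q ω ε D δ η} ⊆ B1 ∪ (B2 ∪ B3) ∪ B4 := by
    intro w hw
    by_contra hnot
    simp only [Set.mem_union, not_or, B1, B2, B3, B4, Set.mem_iUnion, Set.mem_ofPred_eq, not_exists,
      not_and, not_le, not_lt] at hnot
    exact hw ⟨fun a b => (hnot.1.1 a b).le, fun u => (hnot.1.2.1 u).le,
      fun i => (hnot.1.2.2 i).le, hnot.2⟩
  have e0 := Real.exp_nonneg (-((D - 2) * ω))
  have h2 : P.real B2 ≤ N * Real.exp (-((D - 2) * ω)) := by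
    refine (measureReal_iUnion_fintype_le _).trans ?_
    refine (Finset.sum_le_sum fun u _ => h.row_sum_tail_le hF hω hq D u).trans ?_
    simp
  have h3 : P.real B3 ≤ N * Real.exp (-((D - 2) * ω)) := by
    refine (measureReal_iUnion_fintype_le _).trans ?_
    refine (Finset.sum_le_sum fun i _ => h.col_sum_tail_le hω hq D i).trans ?_
    simp only [Finset.sum_const, Finset.card_univ, Fintype.card_fin, nsmul_eq_mul]
    gcongr
  have h1 : P.real B1 ≤ _ := h.exists_sign_le hF hω hq0 hq hε hε1
  have h4 : P.real B4 ≤ _ := h.exists_dense_block_le hF hω hq (δ := δ) ht hη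
  have u1 := measureReal_union_le (μ := P) (B1 ∪ (B2 ∪ B3)) B4
  have u2 := measureReal_union_le (μ := P) B1 (B2 ∪ B3)
  have u3 := measureReal_union_le (μ := P) B2 B3
  have u4 := measureReal_mono (μ := P) hsub (measure_ne_top P _)
  linarith

lemma exp_neg_le_inv_sq {C x : ℝ} (hC : 0 < C) {N : ℕ} (hN : 0 < N) (h : C * Real.log N ≤ x) :
    Real.exp (-(2 / C * x)) ≤ ((N : ℝ) ^ 2)⁻¹ := by
  have hN : (0 : ℝ) < N := by exact_mod_cast hN
  have h1 : 2 * Real.log N ≤ 2 / C * x := by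
    calc 2 * Real.log N = 2 / C * (C * Real.log N) := by field_simp
      _ ≤ _ := by gcongr
  calc Real.exp (-(2 / C * x)) ≤ Real.exp (-(2 * Real.log N)) := by gcongr
    _ = _ := by
      rw [Real.exp_neg, two_mul, Real.exp_add, Real.exp_log hN, sq]

/-- With `D = 2 + 2 / C` and `t = (2 / C + 1) / δ`, both `D - 2` and `tδ - 1` equal `2 / C`, so the
row, column and block bounds all gain `exp (-2ω / C) ≤ N⁻²`, enough against a factor `2N`. The block
size `η` is `exp (-t)`. The sign bound uses `ω → ∞` to beat the `4 ^ N` pairs. -/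
theorem eventually_isQuasirandom {C : ℝ} (hC : 0 < C) {ω : ℕ → ℝ} (hω : Tendsto ω atTop atTop)
    (hlog : ∀ᶠ N : ℕ in atTop, C * Real.log N ≤ ω N) {ε δ ρ : ℝ} (hε : 0 < ε) (hε1 : ε ≤ 1)
    (hδ : 0 < δ) (hρ : 0 < ρ) :
    ∀ᶠ N : ℕ in atTop, ∀ F : ℕ, F ≤ N → ∀ (Ω : Type*) [MeasurableSpace Ω] (P : Measure Ω)
      [IsProbabilityMeasure P] (S : Ω → Matrix (Fin N) (Fin F) ℝ) (q : Matrix (Fin N) (Fin F) ℝ),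
      IsBernoulliMatrix P S q → (∀ u i, 0 ≤ q u i) → (∀ u i, q u i ≤ ω N / N) →
      1 - ρ ≤ P.real {w | IsQuasirandom (S w) q (ω N) ε (2 + 2 / C) δ
        (Real.exp (-((2 / C + 1) / δ)))} := by
  have hinv : Tendsto (fun N : ℕ => (N : ℝ)⁻¹) atTop (𝓝 0) := tendsto_inv_atTop_nhds_zero_nat
  have hlim : Tendsto (fun N : ℕ => Real.exp (-(N : ℝ)) + 2 * (N : ℝ)⁻¹ +
      (Real.exp (2 * (N : ℝ)⁻¹) - 1)) atTop (𝓝 (0 + 2 * 0 + (Real.exp (2 * 0) - 1))) := by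
    refine ((Real.tendsto_exp_neg_atTop_nhds_zero.comp tendsto_natCast_atTop_atTop).add
      (hinv.const_mul 2)).add ?_
    exact (((Real.continuous_exp.tendsto _).comp (hinv.const_mul 2))).sub_const 1
  simp only [mul_zero, add_zero, Real.exp_zero, sub_self] at hlim
  filter_upwards [hlog, hω.eventually_ge_atTop 0, hlim.eventually_lt_const hρ, eventually_gt_atTop 0,
    hω.eventually_ge_atTop (4 / ε ^ 2 * (Real.log 4 + 1))] with N h1 h2 h3 h4 h5
  intro F hF Ω _ P _ S q hS hq0 hq
  have hη : Real.exp ((2 / C + 1) / δ) * Real.exp (-((2 / C + 1) / δ)) ≤ 1 := by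
    rw [← Real.exp_add]; simp
  have hbad := hS.not_isQuasirandom_le hF h2 hq0 hq (δ := δ) hε hε1 (by positivity) hη (2 + 2 / C)
  have hN : (0 : ℝ) < N := by exact_mod_cast h4
  have hexp := exp_neg_le_inv_sq hC h4 h1
  have e1 : (4 : ℝ) ^ N * Real.exp (-(ε ^ 2 / 4 * ω N * N)) ≤ Real.exp (-(N : ℝ)) := by
    have : (4 : ℝ) ^ N = Real.exp (N * Real.log 4) := by
      rw [Real.exp_nat_mul, Real.exp_log (by norm_num)]
    rw [this, ← Real.exp_add]
    refine Real.exp_le_exp.2 ?_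
    have h6 : Real.log 4 + 1 ≤ ε ^ 2 / 4 * ω N := by
      calc Real.log 4 + 1 = ε ^ 2 / 4 * (4 / ε ^ 2 * (Real.log 4 + 1)) := by field_simp
        _ ≤ _ := by gcongr
    nlinarith
  have e2 : 2 * (N : ℝ) * Real.exp (-((2 + 2 / C - 2) * ω N)) ≤ 2 * (N : ℝ)⁻¹ := by
    rw [add_sub_cancel_left]
    calc 2 * (N : ℝ) * Real.exp (-(2 / C * ω N)) ≤ 2 * N * ((N : ℝ) ^ 2)⁻¹ := by gcongr
      _ = _ := by field_simp
  have e3 : Real.exp (2 * N * Real.exp (-(((2 / C + 1) / δ * δ - 1) * ω N))) ≤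
      Real.exp (2 * (N : ℝ)⁻¹) := by
    refine Real.exp_le_exp.2 ?_
    rw [div_mul_cancel₀ _ hδ.ne', add_sub_cancel_right]
    calc 2 * (N : ℝ) * Real.exp (-(2 / C * ω N)) ≤ 2 * N * ((N : ℝ) ^ 2)⁻¹ := by gcongr
      _ = _ := by field_simp
  set G := {w | IsQuasirandom (S w) q (ω N) ε (2 + 2 / C) δ (Real.exp (-((2 / C + 1) / δ)))}
  -- Subadditivity replaces the complement rule, so the event need not be shown measurable.
  have hu : P.real (G ∪ {w | ¬ IsQuasirandom (S w) q (ω N) ε (2 + 2 / C) δ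
      (Real.exp (-((2 / C + 1) / δ)))}) = 1 := by
    have : G ∪ {w | ¬ IsQuasirandom (S w) q (ω N) ε (2 + 2 / C) δ
      (Real.exp (-((2 / C + 1) / δ)))} = Set.univ := Set.union_compl_self G
    rw [this, probReal_univ]
  have hle := measureReal_union_le (μ := P) G {w | ¬ IsQuasirandom (S w) q (ω N) ε (2 + 2 / C) δ
      (Real.exp (-((2 / C + 1) / δ)))}
  linarith

/-! ### Sparse orientations, Schur's test and bilinear forms on cubes. -/

section SchurTest

variable {U I : Type*}

open Classical in
/-- A weighted bipartite graph all of whose small subgraphs are sparse can be oriented such that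
all out-degrees are small. -/
lemma exists_orientation {A : Matrix U I ℝ} {d : ℝ} (hd : 0 ≤ d) {m : ℕ}
    (hA : ∀ (X : Finset U) (T : Finset I), X.card ≤ m → T.card ≤ X.card →
      ∑ u ∈ X, ∑ i ∈ T, A u i ≤ d * X.card) :
    ∀ (n : ℕ) (X : Finset U) (T : Finset I), X.card + T.card = n → X.card ≤ m →
      ∃ o : U → I → Prop, (∀ u ∈ X, ∑ i ∈ T, (if o u i then A u i else 0) ≤ d) ∧
        ∀ i ∈ T, ∑ u ∈ X, (if o u i then 0 else A u i) ≤ d := by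
  intro n
  induction n with
  | zero =>
    intro X T h _
    have hX : X = ∅ := Finset.card_eq_zero.1 (by omega)
    have hT : T = ∅ := Finset.card_eq_zero.1 (by omega)
    exact ⟨fun _ _ => True, by simp [hX], by simp [hT]⟩
  | succ n ih =>
    intro X T h hX
    -- Lines are peeled off one at a time. `o u i` means that the entry is charged to its row; a
    -- peeled row or column is charged with all its remaining entries, so it must have weight at
    -- most `d`. Here averaging over the rows finds one.
    rcases le_or_gt T.card X.card with hTX | hTX
    · have hne : X.Nonempty := Finset.card_pos.1 (by omega)
      obtain ⟨u₀, hu₀, hle⟩ : ∃ u ∈ X, ∑ i ∈ T, A u i ≤ d := by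
        refine Finset.exists_le_of_sum_le hne ((hA X T hX hTX).trans (le_of_eq ?_))
        simp [mul_comm]
      have hcard := Finset.card_erase_of_mem hu₀
      have hpos := Finset.card_pos.2 hne
      obtain ⟨o, h1, h2⟩ := ih (X.erase u₀) T (by omega) (by omega)
      refine ⟨fun u i => u = u₀ ∨ o u i, fun u hu => ?_, fun i hi => ?_⟩
      · by_cases huu : u = u₀
        · simpa [huu] using hle
        · simpa [huu] using h1 u (Finset.mem_erase.2 ⟨huu, hu⟩)
      · rw [← Finset.add_sum_erase X _ hu₀]
        simp only [true_or, if_true, zero_add]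
        refine le_of_eq_of_le (Finset.sum_congr rfl fun u hu => ?_) (h2 i hi)
        simp [Finset.ne_of_mem_erase hu]
    -- With more columns than rows, the sparsity hypothesis applies only to a subset of `#X`
    -- columns; averaging over it finds a light column.
    · obtain ⟨T', hT', hcT'⟩ := Finset.exists_subset_card_eq hTX.le
      obtain ⟨i₀, hi₀, hle⟩ : ∃ i ∈ T, ∑ u ∈ X, A u i ≤ d := by
        rcases X.eq_empty_or_nonempty with rfl | hne
        · obtain ⟨i, hi⟩ : T.Nonempty := Finset.card_pos.1 (by omega)
          exact ⟨i, hi, by simpa using hd⟩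
        · have hne' : T'.Nonempty := Finset.card_pos.1 (by rw [hcT']; exact Finset.card_pos.2 hne)
          obtain ⟨i, hi, hle⟩ : ∃ i ∈ T', ∑ u ∈ X, A u i ≤ d := by
            refine Finset.exists_le_of_sum_le hne' ?_
            rw [Finset.sum_comm]
            refine (hA X T' hX hcT'.le).trans (le_of_eq ?_)
            simp [mul_comm, hcT']
          exact ⟨i, hT' hi, hle⟩
      have hcard := Finset.card_erase_of_mem hi₀
      obtain ⟨o, h1, h2⟩ := ih X (T.erase i₀) (by omega) hX
      refine ⟨fun u i => i ≠ i₀ ∧ o u i, fun u hu => ?_, fun i hi => ?_⟩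
      · rw [← Finset.add_sum_erase T _ hi₀]
        simp only [ne_eq, not_true_eq_false, false_and, if_false, zero_add]
        refine le_of_eq_of_le (Finset.sum_congr rfl fun i hi => ?_) (h1 u hu)
        simp [Finset.ne_of_mem_erase hi]
      · by_cases hii : i = i₀
        · simpa [hii] using hle
        · simpa [hii] using h2 i (Finset.mem_erase.2 ⟨hii, hi⟩)

variable [Fintype U] [Fintype I]

/-- Schur's test for a nonnegative matrix. -/
lemma sq_bilinear_le_of_row_col {A : Matrix U I ℝ} (hA : ∀ u i, 0 ≤ A u i) {r c : ℝ}
    (hc0 : 0 ≤ c) (hr : ∀ u, ∑ i, A u i ≤ r) (hc : ∀ i, ∑ u, A u i ≤ c)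
    (x : U → ℝ) (y : I → ℝ) (hx : ∑ u, x u ^ 2 ≤ 1) (hy : ∑ i, y i ^ 2 ≤ 1) (hr0 : 0 ≤ r) :
    (∑ u, ∑ i, x u * (A u i * y i)) ^ 2 ≤ r * c := by
  have h1 : (∑ e : U × I, x e.1 * (A e.1 e.2 * y e.2)) ^ 2 ≤
      (∑ e : U × I, A e.1 e.2 * x e.1 ^ 2) * ∑ e : U × I, A e.1 e.2 * y e.2 ^ 2 :=
    Finset.sum_sq_le_sum_mul_sum_of_sq_le_mul _
      (fun e _ => mul_nonneg (hA _ _) (sq_nonneg _)) (fun e _ => mul_nonneg (hA _ _) (sq_nonneg _))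
      fun e _ => le_of_eq (by ring)
  simp only [Fintype.sum_prod_type] at h1
  have h2 : ∑ u, ∑ i, A u i * x u ^ 2 ≤ r := by
    calc ∑ u, ∑ i, A u i * x u ^ 2 = ∑ u, (∑ i, A u i) * x u ^ 2 := by simp [Finset.sum_mul]
      _ ≤ ∑ u, r * x u ^ 2 :=
        Finset.sum_le_sum fun u _ => mul_le_mul_of_nonneg_right (hr u) (sq_nonneg _)
      _ = r * ∑ u, x u ^ 2 := by rw [Finset.mul_sum]
      _ ≤ r := mul_le_of_le_one_right hr0 hx
  have h3 : ∑ u, ∑ i, A u i * y i ^ 2 ≤ c := by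
    rw [Finset.sum_comm]
    calc ∑ i, ∑ u, A u i * y i ^ 2 = ∑ i, (∑ u, A u i) * y i ^ 2 := by simp [Finset.sum_mul]
      _ ≤ ∑ i, c * y i ^ 2 :=
        Finset.sum_le_sum fun i _ => mul_le_mul_of_nonneg_right (hc i) (sq_nonneg _)
      _ = c * ∑ i, y i ^ 2 := by rw [Finset.mul_sum]
      _ ≤ c := mul_le_of_le_one_right hc0 hy
  exact h1.trans (mul_le_mul h2 h3
    (Finset.sum_nonneg fun u _ => Finset.sum_nonneg fun i _ => mul_nonneg (hA _ _) (sq_nonneg _))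
    hr0)

/-- The bilinear form of a sparse matrix is small on vectors of small support. -/
lemma bilinear_le_of_small_support {A : Matrix U I ℝ} (hA0 : ∀ u i, 0 ≤ A u i) {d D : ℝ}
    (hd : 0 ≤ d) (hD : 0 ≤ D) {m : ℕ}
    (hA : ∀ (X : Finset U) (T : Finset I), X.card ≤ m → T.card ≤ X.card →
      ∑ u ∈ X, ∑ i ∈ T, A u i ≤ d * X.card)
    (hr : ∀ u, ∑ i, A u i ≤ D) (hc : ∀ i, ∑ u, A u i ≤ D)
    (x : U → ℝ) (y : I → ℝ) (hx : ∑ u, x u ^ 2 ≤ 1) (hy : ∑ i, y i ^ 2 ≤ 1)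
    (X : Finset U) (hX : X.card ≤ m) (hsupp : ∀ u, u ∉ X → x u = 0) :
    ∑ u, ∑ i, x u * (A u i * y i) ≤ 2 * Real.sqrt (d * D) := by
  classical
  obtain ⟨o, h1, h2⟩ := exists_orientation hd hA _ X Finset.univ rfl hX
  -- `A₁` has row sums at most `d` and column sums at most `D`, and `A₂` the reverse, so Schur's
  -- test gives `√(dD)` for each.
  set A₁ : Matrix U I ℝ := fun u i => if u ∈ X then (if o u i then A u i else 0) else 0 with hA₁
  set A₂ : Matrix U I ℝ := fun u i => if u ∈ X then (if o u i then 0 else A u i) else 0 with hA₂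
  have n1 : ∀ u i, 0 ≤ A₁ u i := fun u i => by
    simp only [hA₁]; split_ifs <;> simp [hA0]
  have n2 : ∀ u i, 0 ≤ A₂ u i := fun u i => by
    simp only [hA₂]; split_ifs <;> simp [hA0]
  have l1 : ∀ u i, A₁ u i ≤ A u i := fun u i => by
    simp only [hA₁]; split_ifs <;> simp [hA0]
  have l2 : ∀ u i, A₂ u i ≤ A u i := fun u i => by
    simp only [hA₂]; split_ifs <;> simp [hA0]
  have r1 : ∀ u, ∑ i, A₁ u i ≤ d := fun u => by
    by_cases hu : u ∈ X
    · simpa [hA₁, hu] using h1 u hu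
    · simpa [hA₁, hu] using hd
  have c2 : ∀ i, ∑ u, A₂ u i ≤ d := fun i => by
    simpa [hA₂, Finset.sum_ite_mem] using h2 i (Finset.mem_univ i)
  have c1 : ∀ i, ∑ u, A₁ u i ≤ D := fun i => (Finset.sum_le_sum fun u _ => l1 u i).trans (hc i)
  have r2 : ∀ u, ∑ i, A₂ u i ≤ D := fun u => (Finset.sum_le_sum fun i _ => l2 u i).trans (hr u)
  have b1 := Real.le_sqrt_of_sq_le (sq_bilinear_le_of_row_col n1 hD r1 c1 x y hx hy hd)
  have b2 := Real.le_sqrt_of_sq_le (sq_bilinear_le_of_row_col n2 hd r2 c2 x y hx hy hD)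
  rw [mul_comm D d] at b2
  have hsplit : ∑ u, ∑ i, x u * (A u i * y i) =
      ∑ u, ∑ i, x u * (A₁ u i * y i) + ∑ u, ∑ i, x u * (A₂ u i * y i) := by
    simp only [← Finset.sum_add_distrib]
    refine Finset.sum_congr rfl fun u _ => Finset.sum_congr rfl fun i _ => ?_
    by_cases hu : u ∈ X
    · by_cases ho : o u i <;> simp [hA₁, hA₂, hu, ho]
    · simp [hsupp u hu]
  linarith

lemma exists_signs_sum_le (c : U → ℝ) :
    ∃ s : U → ℤˣ, ∀ a : U → ℝ, (∀ u, |a u| ≤ 1) → ∑ u, a u * c u ≤ ∑ u, (s u : ℤ) * c u := by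
  refine ⟨fun u => if 0 ≤ c u then 1 else -1, fun a ha => Finset.sum_le_sum fun u _ => ?_⟩
  have h1 : a u * c u ≤ |c u| := by
    calc a u * c u ≤ |a u * c u| := le_abs_self _
      _ = |a u| * |c u| := abs_mul _ _
      _ ≤ |c u| := mul_le_of_le_one_left (abs_nonneg _) (ha u)
  refine h1.trans (le_of_eq ?_)
  by_cases h : 0 ≤ c u
  · simp [h, abs_of_nonneg h]
  · simp [h, abs_of_neg (not_le.1 h)]

/-- A bilinear form on a product of cubes is maximal at a pair of vertices. -/
lemma bilinear_le_of_signs {W : Matrix U I ℝ} {τ : ℝ}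
    (h : ∀ (a : U → ℤˣ) (b : I → ℤˣ), ∑ u, ∑ i, (a u : ℤ) * (W u i * (b i : ℤ)) ≤ τ)
    (x : U → ℝ) (y : I → ℝ) (hx : ∀ u, |x u| ≤ 1) (hy : ∀ i, |y i| ≤ 1) :
    ∑ u, ∑ i, x u * (W u i * y i) ≤ τ := by
  -- The form is linear in each argument, so `x` is replaced by signs with `y` fixed, and then `y`
  -- with these signs fixed.
  obtain ⟨s, hs⟩ := exists_signs_sum_le fun u => ∑ i, W u i * y i
  obtain ⟨t, ht⟩ := exists_signs_sum_le fun i => ∑ u, (s u : ℤ) * W u i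
  have h1 := hs x hx
  have h2 := ht y hy
  simp only [Finset.mul_sum] at h1 h2
  refine h1.trans (le_trans (le_of_eq ?_) (h2.trans (le_trans (le_of_eq ?_) (h s t))))
  · rw [Finset.sum_comm]
    exact Finset.sum_congr rfl fun i _ => Finset.sum_congr rfl fun u _ => by ring
  · rw [Finset.sum_comm]
    exact Finset.sum_congr rfl fun i _ => Finset.sum_congr rfl fun u _ => by ring

/-- Number of large coordinates, and sum of large coordinates, of a vector in the unit ball. -/
lemma card_large_le {x : U → ℝ} (hx : ∑ u, x u ^ 2 ≤ 1) {b : ℝ} (hb : 0 < b) :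
    ((Finset.univ.filter fun u => b < |x u|).card : ℝ) * b ^ 2 ≤ 1 := by
  calc ((Finset.univ.filter fun u => b < |x u|).card : ℝ) * b ^ 2
      = ∑ u ∈ Finset.univ.filter fun u => b < |x u|, b ^ 2 := by simp
    _ ≤ ∑ u ∈ Finset.univ.filter fun u => b < |x u|, x u ^ 2 := by
        refine Finset.sum_le_sum fun u hu => ?_
        rw [← sq_abs (x u)]
        have := (Finset.mem_filter.1 hu).2
        gcongr
    _ ≤ ∑ u, x u ^ 2 := Finset.sum_le_sum_of_subset_of_nonneg (Finset.filter_subset _ _)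
        fun _ _ _ => sq_nonneg _
    _ ≤ 1 := hx

lemma sum_abs_large_le {x : U → ℝ} (hx : ∑ u, x u ^ 2 ≤ 1) {b : ℝ} (hb : 0 < b) :
    ∑ u, |if b < |x u| then x u else 0| ≤ 1 / b := by
  calc ∑ u, |if b < |x u| then x u else 0| ≤ ∑ u, x u ^ 2 / b := by
        refine Finset.sum_le_sum fun u _ => ?_
        split_ifs with h
        · rw [le_div_iff₀ hb, ← sq_abs, sq]
          exact mul_le_mul_of_nonneg_left h.le (abs_nonneg _)
        · simpa using by positivity
    _ = (∑ u, x u ^ 2) / b := by rw [Finset.sum_div]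
    _ ≤ 1 / b := by gcongr

lemma sum_abs_le_sqrt {y : I → ℝ} (hy : ∑ i, y i ^ 2 ≤ 1) {n : ℕ} (hn : Fintype.card I ≤ n) :
    ∑ i, |y i| ≤ Real.sqrt n := by
  refine Real.le_sqrt_of_sq_le ?_
  have h1 := sq_sum_le_card_mul_sum_sq (s := Finset.univ) (f := fun i => |y i|)
  simp only [sq_abs, Finset.card_univ] at h1
  have hn' : (Fintype.card I : ℝ) ≤ n := by exact_mod_cast hn
  calc _ ≤ _ := h1
    _ ≤ (Fintype.card I : ℝ) * 1 := by gcongr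
    _ ≤ n := by simpa using hn'

lemma abs_bilinear_le {M : Matrix U I ℝ} {p : ℝ} (hM : ∀ u i, |M u i| ≤ p) (x : U → ℝ)
    (y : I → ℝ) : |∑ u, ∑ i, x u * (M u i * y i)| ≤ p * ((∑ u, |x u|) * ∑ i, |y i|) := by
  rw [Finset.sum_mul_sum, Finset.mul_sum]
  refine (Finset.abs_sum_le_sum_abs _ _).trans (Finset.sum_le_sum fun u _ => ?_)
  rw [Finset.mul_sum]
  refine (Finset.abs_sum_le_sum_abs _ _).trans (Finset.sum_le_sum fun i _ => ?_)
  rw [abs_mul, abs_mul]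
  calc |x u| * (|M u i| * |y i|) = |M u i| * (|x u| * |y i|) := by ring
    _ ≤ p * (|x u| * |y i|) := by gcongr; exact hM u i

end SchurTest

/-! ### Operator norm of the noise. -/

/-- Part of the bilinear form of the noise supported on the large coordinates of the first
argument. -/
lemma noise_large_le {U I : Type*} [Fintype U] [Fintype I] {A M : Matrix U I ℝ}
    (hA0 : ∀ u i, 0 ≤ A u i) {n : ℕ} (hn : 0 < n)
    (hI : Fintype.card I ≤ n) {ω δ D η B : ℝ} (hω : 0 ≤ ω) (hδ : 0 ≤ δ) (hD : 0 ≤ D)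
    (hB : 0 < B) (hηB : 2 ≤ η * B ^ 2) (hM : ∀ u i, |M u i| ≤ ω / n)
    (hblock : ∀ (X : Finset U) (T : Finset I), (X.card + T.card : ℝ) ≤ η * n →
      ∑ u ∈ X, ∑ i ∈ T, A u i ≤ δ * ω * (X.card + T.card))
    (hr : ∀ u, ∑ i, A u i ≤ D * ω) (hc : ∀ i, ∑ u, A u i ≤ D * ω)
    (x : U → ℝ) (y : I → ℝ) (hx : ∑ u, x u ^ 2 ≤ 1) (hy : ∑ i, y i ^ 2 ≤ 1) :
    ∑ u, ∑ i, (if B / Real.sqrt n < |x u| then x u else 0) * ((A u i - M u i) * y i) ≤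
      (2 * Real.sqrt (2 * δ * D) + 1 / B) * ω := by
  have hn' : (0 : ℝ) < n := by exact_mod_cast hn
  have hs : 0 < Real.sqrt n := Real.sqrt_pos.2 hn'
  set b := B / Real.sqrt n with hb
  have hb0 : 0 < b := by positivity
  set x' : U → ℝ := fun u => if b < |x u| then x u else 0 with hx'
  have hx1 : ∑ u, x' u ^ 2 ≤ 1 := by
    refine le_trans (Finset.sum_le_sum fun u _ => ?_) hx
    simp only [hx']
    split_ifs
    · exact le_rfl
    · simpa using sq_nonneg (x u)
  set X := Finset.univ.filter fun u => b < |x u| with hX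
  have hXc : (X.card : ℝ) * 2 ≤ η * n := by
    have h1 := card_large_le hx hb0
    have h2 : b ^ 2 = B ^ 2 / n := by rw [hb, div_pow, Real.sq_sqrt hn'.le]
    rw [h2, ← mul_div_assoc, div_le_one hn'] at h1
    have hη : 0 ≤ η := by
      by_contra hneg
      push Not at hneg
      nlinarith [sq_nonneg B]
    calc (X.card : ℝ) * 2 ≤ X.card * (η * B ^ 2) := by gcongr
      _ = η * (X.card * B ^ 2) := by ring
      _ ≤ η * n := by gcongr
  -- The blocks in question have at most as many columns as rows, hence at most `2 * X.card ≤ ηn`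
  -- vertices; the same comparison turns `δω` per vertex into `d = 2δω` per row.
  have hsmall := bilinear_le_of_small_support hA0 (d := 2 * δ * ω) (D := D * ω) (by positivity)
    (by positivity) (m := X.card) (fun Y T hY hT => ?_) hr hc x' y hx1 hy X le_rfl
    (fun u hu => ?_)
  · have hsq : Real.sqrt (2 * δ * ω * (D * ω)) = Real.sqrt (2 * δ * D) * ω := by
      rw [show 2 * δ * ω * (D * ω) = 2 * δ * D * ω ^ 2 by ring, Real.sqrt_mul (by positivity),
        Real.sqrt_sq hω]
    rw [hsq] at hsmall
    have hmean := (abs_le.1 (abs_bilinear_le hM x' y)).1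
    -- The mean is bounded separately: heavy coordinates have `ℓ¹` norm at most `√n / B`, and `y` at
    -- most `√n`.
    have hprod : ω / n * ((∑ u, |x' u|) * ∑ i, |y i|) ≤ 1 / B * ω := by
      have h1 : ∑ u, |x' u| ≤ 1 / b := sum_abs_large_le hx hb0
      have h2 := sum_abs_le_sqrt hy hI
      calc ω / n * ((∑ u, |x' u|) * ∑ i, |y i|) ≤ ω / n * (1 / b * Real.sqrt n) := by
            gcongr
        _ = 1 / B * ω * (Real.sqrt n ^ 2 / n) := by rw [hb]; field_simp
        _ = _ := by rw [Real.sq_sqrt hn'.le, div_self hn'.ne', mul_one]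
    have hsplit : ∑ u, ∑ i, x' u * ((A u i - M u i) * y i) =
        ∑ u, ∑ i, x' u * (A u i * y i) - ∑ u, ∑ i, x' u * (M u i * y i) := by
      simp only [← Finset.sum_sub_distrib]
      exact Finset.sum_congr rfl fun u _ => Finset.sum_congr rfl fun i _ => by ring
    rw [hsplit]
    linarith
  · have hYc : (Y.card : ℝ) ≤ X.card := by exact_mod_cast hY
    have hTc : (T.card : ℝ) ≤ Y.card := by exact_mod_cast hT
    refine (hblock Y T (by linarith)).trans ?_
    calc δ * ω * (Y.card + T.card) ≤ δ * ω * (Y.card + Y.card) := by gcongr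
      _ = _ := by ring
  · simp only [hX, Finset.mem_filter, Finset.mem_univ, true_and] at hu
    simp [hx', hu]

/-- The noise of a quasirandom matrix is small in operator norm. -/
lemma IsQuasirandom.bilinear_le {N F : ℕ} {A M : Matrix (Fin N) (Fin F) ℝ} {ω ε D δ η B : ℝ}
    (h : IsQuasirandom A M ω ε D δ η) (hA0 : ∀ u i, 0 ≤ A u i) (hN : 0 < N) (hF : F ≤ N)
    (hω : 0 ≤ ω) (hδ : 0 ≤ δ) (hD : 0 ≤ D) (hB : 0 < B) (hηB : 2 ≤ η * B ^ 2)
    (hM : ∀ u i, |M u i| ≤ ω / N) (x : Fin N → ℝ) (y : Fin F → ℝ) (hx : ∑ u, x u ^ 2 ≤ 1)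
    (hy : ∑ i, y i ^ 2 ≤ 1) :
    ∑ u, ∑ i, x u * ((A u i - M u i) * y i) ≤
      (B ^ 2 * ε + 4 * Real.sqrt (2 * δ * D) + 2 / B) * ω := by
  have hn' : (0 : ℝ) < N := by exact_mod_cast hN
  have hs : 0 < Real.sqrt N := Real.sqrt_pos.2 hn'
  set b := B / Real.sqrt N with hb
  have hb0 : 0 < b := by positivity
  set x₁ : Fin N → ℝ := fun u => if b < |x u| then x u else 0 with hx₁
  set x₀ : Fin N → ℝ := fun u => if b < |x u| then 0 else x u with hx₀
  set y₁ : Fin F → ℝ := fun u => if b < |y u| then y u else 0 with hy₁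
  set y₀ : Fin F → ℝ := fun u => if b < |y u| then 0 else y u with hy₀
  have hxs : ∀ u, x u = x₀ u + x₁ u := fun u => by simp only [hx₀, hx₁]; split_ifs <;> simp
  have hys : ∀ u, y u = y₀ u + y₁ u := fun u => by simp only [hy₀, hy₁]; split_ifs <;> simp
  have t1 : ∑ u, ∑ i, x₁ u * ((A u i - M u i) * y i) ≤
      (2 * Real.sqrt (2 * δ * D) + 1 / B) * ω :=
    noise_large_le hA0 hN (by simpa using hF) hω hδ hD hB hηB hM h.block h.row h.col
      x y hx hy
  have hx0 : ∑ u, x₀ u ^ 2 ≤ 1 := by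
    refine le_trans (Finset.sum_le_sum fun u _ => ?_) hx
    simp only [hx₀]
    split_ifs
    · simpa using sq_nonneg (x u)
    · exact le_rfl
  have t2 : ∑ i, ∑ u, y₁ i * ((Aᵀ i u - Mᵀ i u) * x₀ u) ≤
      (2 * Real.sqrt (2 * δ * D) + 1 / B) * ω := by
    refine noise_large_le (A := Aᵀ) (M := Mᵀ) (fun i u => hA0 u i) hN (by simp)
      hω hδ hD hB hηB (fun i u => hM u i) (fun T X hTX => ?_) h.col h.row y x₀ hy hx0
    simp only [Matrix.transpose_apply]
    rw [Finset.sum_comm, add_comm (T.card : ℝ)]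
    exact h.block X T (by linarith)
  -- Divided by `b`, the light parts lie in the cube; undoing the scaling costs `b² = B² / N`.
  have t3 : ∑ u, ∑ i, x₀ u / b * ((A u i - M u i) * (y₀ i / b)) ≤ ε * ω * N := by
    refine bilinear_le_of_signs (W := fun u i => A u i - M u i) h.sign _ _ (fun u => ?_) fun i => ?_
    · rw [abs_div, abs_of_pos hb0, div_le_one hb0]
      simp only [hx₀]
      split_ifs with hu
      · simpa using hb0.le
      · exact not_lt.1 hu
    · rw [abs_div, abs_of_pos hb0, div_le_one hb0]
      simp only [hy₀]
      split_ifs with hu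
      · simpa using hb0.le
      · exact not_lt.1 hu
  have hb2 : b ^ 2 * N = B ^ 2 := by
    rw [hb, div_pow, Real.sq_sqrt hn'.le]; field_simp
  have t3' : ∑ u, ∑ i, x₀ u * ((A u i - M u i) * y₀ i) ≤ B ^ 2 * ε * ω := by
    have : ∑ u, ∑ i, x₀ u * ((A u i - M u i) * y₀ i) =
        b ^ 2 * ∑ u, ∑ i, x₀ u / b * ((A u i - M u i) * (y₀ i / b)) := by
      simp only [Finset.mul_sum]
      exact Finset.sum_congr rfl fun u _ => Finset.sum_congr rfl fun i _ => by field_simp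
    rw [this]
    calc _ ≤ b ^ 2 * (ε * ω * N) := by gcongr
      _ = (b ^ 2 * N) * ε * ω := by ring
      _ = _ := by rw [hb2]
  -- Keeping `y` whole beside `x₁` leaves only two heavy terms; the one with `y₁` is the same
  -- estimate for the transpose.
  have hsplit : ∑ u, ∑ i, x u * ((A u i - M u i) * y i) =
      ∑ u, ∑ i, x₀ u * ((A u i - M u i) * y₀ i) + ∑ u, ∑ i, x₁ u * ((A u i - M u i) * y i) +
        ∑ i, ∑ u, y₁ i * ((Aᵀ i u - Mᵀ i u) * x₀ u) := by
    rw [Finset.sum_comm (s := Finset.univ (α := Fin F))]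
    simp only [← Finset.sum_add_distrib, Matrix.transpose_apply]
    refine Finset.sum_congr rfl fun u _ => Finset.sum_congr rfl fun i _ => ?_
    rw [hxs u, hys i]; ring
  rw [hsplit]
  have : (B ^ 2 * ε + 4 * Real.sqrt (2 * δ * D) + 2 / B) * ω = B ^ 2 * ε * ω +
      (2 * Real.sqrt (2 * δ * D) + 1 / B) * ω + (2 * Real.sqrt (2 * δ * D) + 1 / B) * ω := by ring
  linarith

/-! ### Perturbation of top eigenvectors through Ky Fan's inequality. -/

/-- A weighted sum with weights in `[0, 1]` of total mass at most `#T` is at most the sum over the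
indices `T` of the largest terms, with a loss proportional to the gap. -/
lemma sum_mul_le_of_gap {ι : Type*} [Fintype ι] {a w : ι → ℝ} {T : Finset ι} {t θ : ℝ}
    (hθ : θ ≤ t) (hT : ∀ i ∈ T, t ≤ a i) (hT' : ∀ i ∉ T, a i ≤ t - θ) (hw0 : ∀ i, 0 ≤ w i)
    (hw1 : ∀ i, w i ≤ 1) (hsum : ∑ i, w i ≤ T.card) :
    ∑ i, a i * w i ≤ ∑ i ∈ T, a i - θ * (T.card - ∑ i ∈ T, w i) := by
  classical
  have h1 : ∑ i ∈ Tᶜ, a i * w i ≤ (t - θ) * ∑ i ∈ Tᶜ, w i := by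
    rw [Finset.mul_sum]
    exact Finset.sum_le_sum fun i hi =>
      mul_le_mul_of_nonneg_right (hT' i (Finset.mem_compl.1 hi)) (hw0 i)
  have h2 : t * (T.card - ∑ i ∈ T, w i) ≤ ∑ i ∈ T, a i - ∑ i ∈ T, a i * w i := by
    have : t * ((T.card : ℝ) - ∑ i ∈ T, w i) = ∑ i ∈ T, t * (1 - w i) := by
      rw [← Finset.mul_sum, Finset.sum_sub_distrib]; simp
    rw [this, ← Finset.sum_sub_distrib]
    refine Finset.sum_le_sum fun i hi => ?_
    have := mul_le_mul_of_nonneg_right (hT i hi) (sub_nonneg.2 (hw1 i))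
    linarith
  have h3 := Finset.sum_add_sum_compl T fun i => a i * w i
  have h4 := Finset.sum_add_sum_compl T w
  -- The mass outside `T` is at most the mass missing inside; `θ ≤ t` gives the factor `t - θ` the
  -- right sign.
  have h5 : (t - θ) * ∑ i ∈ Tᶜ, w i ≤ (t - θ) * (T.card - ∑ i ∈ T, w i) :=
    mul_le_mul_of_nonneg_left (by linarith) (by linarith)
  linarith

section Perturbation

variable {E : Type*} [NormedAddCommGroup E] [InnerProductSpace ℝ E]

lemma sum_sq_inner_le_one {ι : Type*} {v : ι → E} (hv : Orthonormal ℝ v) (s : Finset ι) {y : E}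
    (hy : ‖y‖ = 1) : ∑ i ∈ s, inner ℝ (v i) y ^ 2 ≤ 1 := by
  have h := hv.sum_inner_products_le (s := s) y
  simpa [hy] using h

lemma sum_mul_sq_inner_self {ι : Type*} [Fintype ι] [DecidableEq ι] {v : ι → E}
    (hv : Orthonormal ℝ v) (a : ι → ℝ) (j : ι) : ∑ i, a i * inner ℝ (v i) (v j) ^ 2 = a j := by
  rw [Finset.sum_eq_single j]
  · simp [hv.1 j]
  · intro i _ hij
    simp [hv.2 hij]
  · simp

/-- Ky Fan's inequality, with a loss proportional to the gap. -/
lemma sum_quadratic_le_of_gap {ι J : Type*} [Fintype ι] {v : ι → E} (hv : Orthonormal ℝ v)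
    {y : J → E} (hy : Orthonormal ℝ y) (S : Finset J) {a : ι → ℝ} {T : Finset ι}
    (hcard : T.card = S.card) {t θ : ℝ} (hθ : θ ≤ t) (hT : ∀ i ∈ T, t ≤ a i)
    (hT' : ∀ i ∉ T, a i ≤ t - θ) :
    ∑ j ∈ S, ∑ i, a i * inner ℝ (v i) (y j) ^ 2 ≤
      ∑ i ∈ T, a i - θ * (S.card - ∑ i ∈ T, ∑ j ∈ S, inner ℝ (v i) (y j) ^ 2) := by
  -- The weight of `i` becomes `∑ j ∈ S, ⟪v i, y j⟫²`: Bessel for `y` bounds it by `1`, and Bessel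
  -- for `v` bounds the total by `#S`.
  rw [Finset.sum_comm]
  simp only [← Finset.mul_sum]
  rw [← hcard]
  refine sum_mul_le_of_gap hθ hT hT' (fun i => Finset.sum_nonneg fun _ _ => sq_nonneg _)
    (fun i => ?_) ?_
  · simp only [real_inner_comm _ (v i)]
    simpa only [real_inner_comm] using sum_sq_inner_le_one hy S (hv.1 i)
  · rw [Finset.sum_comm, hcard]
    refine (Finset.sum_le_sum fun j _ => sum_sq_inner_le_one hv Finset.univ (hy.1 j)).trans ?_
    simp

variable {κ : Type*} [Fintype κ] {F L : ℕ}

/-- The top eigenspaces of two quadratic forms that are close to each other are close. -/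
lemma gap_mul_defect_le [DecidableEq κ] {V : κ → E} (hV : Orthonormal ℝ V) {X : Fin F → E}
    (hX : Orthonormal ℝ X) {a : κ → ℝ} {b : Fin F → ℝ} (hb : Antitone b) (hb0 : ∀ i, 0 ≤ b i)
    {ν : ℝ} (hdiff : ∀ y : E, ‖y‖ = 1 →
      |∑ k, a k * inner ℝ (V k) y ^ 2 - ∑ i, b i * inner ℝ (X i) y ^ 2| ≤ ν)
    (hL : L ≤ F) {e : Fin L → κ} (he : Function.Injective e) {θ : ℝ} (hθ1 : ∀ l, θ ≤ a (e l))
    (hanti : Antitone (a ∘ e)) (hθ2 : ∀ l k, (∀ j ≤ l, k ≠ e j) → a k ≤ a (e l) - θ) (l : Fin L) :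
    θ * ((Finset.Iic l).card - ∑ m ∈ Finset.Iic l, ∑ j ∈ Finset.Iic l,
      inner ℝ (V (e m)) (X (Fin.castLE hL j)) ^ 2) ≤ 2 * (Finset.Iic l).card * ν := by
  set J := Finset.Iic l with hJ
  set X' : Fin L → E := fun j => X (Fin.castLE hL j) with hX'
  have hcast : Function.Injective (Fin.castLE hL) := Fin.castLE_injective hL
  have hXo : Orthonormal ℝ X' := hX.comp _ hcast
  have hVo : Orthonormal ℝ (V ∘ e) := hV.comp _ he
  -- Ky Fan is used for `b` at the vectors `V (e j)` without gap, and for `a` at the vectors `X j`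
  -- with gap `θ`; `hdiff` at these `2 * #J` unit vectors links the two. As `V` need not span, its
  -- orthogonal complement counts as eigenvalue `0`, and `hθ1` keeps the top values `θ` away from
  -- it.
  have h1 := sum_quadratic_le_of_gap hX hVo J (a := b) (T := J.map ⟨_, hcast⟩)
    (by simp) (t := b (Fin.castLE hL l)) (θ := 0) (hb0 _) (fun i hi => ?_) fun i hi => ?_
  · have h2 := sum_quadratic_le_of_gap hV hXo J (a := a) (T := J.map ⟨_, he⟩)
      (by simp) (t := a (e l)) (θ := θ) (hθ1 l) (fun k hk => ?_) fun k hk => ?_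
    · simp only [Finset.sum_map, Function.Embedding.coeFn_mk, zero_mul, sub_zero] at h1 h2
      have h3 : ∑ j ∈ J, a (e j) ≤
          ∑ j ∈ J, ∑ i, b i * inner ℝ (X i) ((V ∘ e) j) ^ 2 + J.card * ν := by
        rw [← nsmul_eq_mul, ← Finset.sum_const, ← Finset.sum_add_distrib]
        refine Finset.sum_le_sum fun j _ => ?_
        have := (abs_le.1 (hdiff (V (e j)) (hV.1 _))).2
        rw [sum_mul_sq_inner_self hV] at this
        simp only [Function.comp_apply]
        linarith
      have h4 : ∑ j ∈ J, b (Fin.castLE hL j) ≤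
          ∑ j ∈ J, ∑ k, a k * inner ℝ (V k) (X' j) ^ 2 + J.card * ν := by
        rw [← nsmul_eq_mul, ← Finset.sum_const, ← Finset.sum_add_distrib]
        refine Finset.sum_le_sum fun j _ => ?_
        have := (abs_le.1 (hdiff (X' j) (hX.1 _))).1
        rw [hX', sum_mul_sq_inner_self hX] at this
        simp only [hX']
        linarith
      linarith
    · simp only [Finset.mem_map, Function.Embedding.coeFn_mk] at hk
      obtain ⟨j, hj, rfl⟩ := hk
      exact hanti (Finset.mem_Iic.1 hj)
    · refine hθ2 l k fun j hj hkj => hk ?_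
      simp only [Finset.mem_map, Function.Embedding.coeFn_mk]
      exact ⟨j, Finset.mem_Iic.2 hj, hkj.symm⟩
  · simp only [Finset.mem_map, Function.Embedding.coeFn_mk] at hi
    obtain ⟨j, hj, rfl⟩ := hi
    have hjl : j ≤ l := Finset.mem_Iic.1 hj
    exact hb (Fin.le_def.2 (Fin.le_def.1 hjl))
  · rw [sub_zero]
    refine hb ?_
    by_contra hlt
    rw [not_le] at hlt
    refine hi ?_
    simp only [Finset.mem_map, Function.Embedding.coeFn_mk]
    refine ⟨⟨i, lt_trans hlt l.isLt⟩, Finset.mem_Iic.2 (Fin.le_def.2 (le_of_lt hlt)), by ext; simp⟩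

/-- Simple top eigenvectors of two quadratic forms that are close to each other are close. -/
theorem gap_mul_one_sub_sq_inner_le {V : κ → E} (hV : Orthonormal ℝ V) {X : Fin F → E}
    (hX : Orthonormal ℝ X) {a : κ → ℝ} {b : Fin F → ℝ} (hb : Antitone b) (hb0 : ∀ i, 0 ≤ b i)
    {ν : ℝ} (hdiff : ∀ y : E, ‖y‖ = 1 →
      |∑ k, a k * inner ℝ (V k) y ^ 2 - ∑ i, b i * inner ℝ (X i) y ^ 2| ≤ ν)
    (hL : L ≤ F) {e : Fin L → κ} (he : Function.Injective e) {θ : ℝ} (hθ0 : 0 ≤ θ)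
    (hθ1 : ∀ l, θ ≤ a (e l))
    (hanti : Antitone (a ∘ e)) (hθ2 : ∀ l k, (∀ j ≤ l, k ≠ e j) → a k ≤ a (e l) - θ) (l : Fin L) :
    θ * (1 - inner ℝ (V (e l)) (X (Fin.castLE hL l)) ^ 2) ≤ 4 * L * ν := by
  classical
  set c : Fin L → Fin L → ℝ := fun m j => inner ℝ (V (e m)) (X (Fin.castLE hL j)) ^ 2 with hc
  have hν : 0 ≤ ν := (abs_nonneg _).trans (hdiff (V (e l)) (hV.1 _))
  have hIic := gap_mul_defect_le hV hX hb hb0 hdiff hL he hθ1 hanti hθ2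
  change ∀ l : Fin L, θ * ((Finset.Iic l).card - ∑ m ∈ Finset.Iic l, ∑ j ∈ Finset.Iic l, c m j) ≤ _
    at hIic
  have hIio : θ * ((Finset.Iio l).card - ∑ m ∈ Finset.Iio l, ∑ j ∈ Finset.Iio l, c m j) ≤
      2 * (Finset.Iio l).card * ν := by
    rcases Nat.eq_zero_or_pos l.val with h0 | h0
    · have : Finset.Iio l = ∅ := by
        ext j
        rw [Finset.mem_Iio, Fin.lt_def]
        simp [h0]
      simp [this]
    · have : Finset.Iio l = Finset.Iic ⟨l.val - 1, by omega⟩ := by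
        ext j
        rw [Finset.mem_Iio, Finset.mem_Iic, Fin.lt_def, Fin.le_def]
        simp only
        omega
      rw [this]
      exact hIic _
  have hVo : Orthonormal ℝ (V ∘ e) := hV.comp _ he
  have hXo : Orthonormal ℝ (X ∘ Fin.castLE hL) := hX.comp _ (Fin.castLE_injective hL)
  have hins : Finset.Iic l = insert l (Finset.Iio l) := (Finset.Iio_insert l).symm
  have hnot : l ∉ Finset.Iio l := by simp
  have hrow : ∑ m ∈ Finset.Iio l, ∑ j ∈ Finset.Iio l, c m j + ∑ m ∈ Finset.Iio l, c m l ≤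
      (Finset.Iio l).card := by
    rw [← Finset.sum_add_distrib]
    refine (Finset.sum_le_sum (g := fun _ => (1 : ℝ)) fun m _ => ?_).trans (by simp)
    have := sum_sq_inner_le_one hXo (Finset.Iic l) (hV.1 (e m))
    rw [hins, Finset.sum_insert hnot] at this
    simp only [hc, real_inner_comm _ (V (e m))] at this ⊢
    simpa [add_comm] using this
  have hcol : ∑ m ∈ Finset.Iio l, ∑ j ∈ Finset.Iio l, c m j + ∑ j ∈ Finset.Iio l, c l j ≤
      (Finset.Iio l).card := by
    rw [Finset.sum_comm, ← Finset.sum_add_distrib]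
    refine (Finset.sum_le_sum (g := fun _ => (1 : ℝ)) fun j _ => ?_).trans (by simp)
    have := sum_sq_inner_le_one hVo (Finset.Iic l) (hX.1 (Fin.castLE hL j))
    rw [hins, Finset.sum_insert hnot] at this
    simpa [add_comm] using this
  have hl := hIic l
  have hcard : ((Finset.Iic l).card : ℝ) = (Finset.Iio l).card + 1 := by
    rw [hins, Finset.card_insert_of_notMem hnot]; push_cast; ring
  have hcardL : ((Finset.Iic l).card : ℝ) ≤ L := by
    rw [Fin.card_Iic]; exact_mod_cast l.isLt
  have hexp : ∑ m ∈ Finset.Iic l, ∑ j ∈ Finset.Iic l, c m j =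
      c l l + ∑ j ∈ Finset.Iio l, c l j + (∑ m ∈ Finset.Iio l, c m l +
        ∑ m ∈ Finset.Iio l, ∑ j ∈ Finset.Iio l, c m j) := by
    rw [hins, Finset.sum_insert hnot]
    simp only [Finset.sum_insert hnot, Finset.sum_add_distrib]
  set n : ℝ := ((Finset.Iio l).card : ℝ)
  set Q := ∑ m ∈ Finset.Iio l, ∑ j ∈ Finset.Iio l, c m j
  rw [hexp, hcard] at hl
  -- By Bessel, the off-diagonal parts of the new row and column are each at most `n - Q`. Hence `1
  -- - c l l` is at most the sum of the defects for `Iic l` and `Iio l`.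
  have hkey : θ * (1 - c l l) ≤ θ * (n + 1 - (c l l + ∑ j ∈ Finset.Iio l, c l j +
      (∑ m ∈ Finset.Iio l, c m l + Q))) + θ * (n - Q) := by
    rw [← mul_add]
    exact mul_le_mul_of_nonneg_left (by linarith) hθ0
  have : 2 * (n + 1) * ν + 2 * n * ν ≤ 4 * L * ν := by nlinarith
  change θ * (1 - c l l) ≤ _
  linarith

end Perturbation

/-! ### Symmetrisation and spectral resolution of the matrix `G`. -/

section Spectral

variable {K K' : ℕ}

/-- The symmetric matrix similar to `affinityGram R α β`. -/
noncomputable def symGram (R : Matrix (Fin K) (Fin K') ℝ) (α : Fin K → ℝ) (β : Fin K' → ℝ) :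
    Matrix (Fin K) (Fin K) ℝ :=
  Matrix.diagonal (fun k => Real.sqrt (α k)) *
    (R * Matrix.diagonal β * Rᵀ * Matrix.diagonal fun k => Real.sqrt (α k))

variable {R : Matrix (Fin K) (Fin K') ℝ} {α : Fin K → ℝ} {β : Fin K' → ℝ}

lemma isHermitian_symGram : (symGram R α β).IsHermitian := by
  unfold symGram Matrix.IsHermitian
  simp [Matrix.conjTranspose_eq_transpose_of_trivial, Matrix.transpose_mul, Matrix.mul_assoc]

lemma affinityGram_eq_mul_sqrt (hα : ∀ k, 0 < α k) :
    affinityGram R α β = R * Matrix.diagonal β * Rᵀ * Matrix.diagonal (fun k => Real.sqrt (α k)) *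
      Matrix.diagonal fun k => Real.sqrt (α k) := by
  rw [Matrix.mul_assoc _ (Matrix.diagonal _) (Matrix.diagonal _), Matrix.diagonal_mul_diagonal]
  simp [affinityGram, Real.mul_self_sqrt (hα _).le]

lemma charpoly_symGram (hα : ∀ k, 0 < α k) :
    (symGram R α β).charpoly = (affinityGram R α β).charpoly := by
  rw [symGram, Matrix.charpoly_mul_comm, affinityGram_eq_mul_sqrt hα]

lemma isUnit_det_diagonal_of_pos {r : Fin K → ℝ} (hr : ∀ k, 0 < r k) :
    IsUnit (Matrix.diagonal r).det := by
  rw [Matrix.det_diagonal]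
  exact (Finset.prod_pos fun k _ => hr k).ne'.isUnit

lemma rank_symGram (hα : ∀ k, 0 < α k) :
    (symGram R α β).rank = (affinityGram R α β).rank := by
  have hr : ∀ k, 0 < Real.sqrt (α k) := fun k => Real.sqrt_pos.2 (hα k)
  rw [symGram, Matrix.rank_mul_eq_right_of_isUnit_det _ _ (isUnit_det_diagonal_of_pos hr),
    affinityGram_eq_mul_sqrt hα,
    Matrix.rank_mul_eq_left_of_isUnit_det _ (R * _ * _ * _) (isUnit_det_diagonal_of_pos hr)]

lemma dotProduct_symGram (Y : Fin K → ℝ) (hα : ∀ k, 0 < α k) :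
    (fun k => Y k / Real.sqrt (α k)) ⬝ᵥ symGram R α β *ᵥ (fun k => Y k / Real.sqrt (α k)) =
      ∑ k', β k' * (∑ k, R k k' * Y k) ^ 2 := by
  have hr : ∀ k, Real.sqrt (α k) ≠ 0 := fun k => (Real.sqrt_pos.2 (hα k)).ne'
  have hD : Matrix.diagonal (fun k => Real.sqrt (α k)) *ᵥ (fun k => Y k / Real.sqrt (α k)) = Y := by
    ext k
    rw [Matrix.mulVec_diagonal]
    field_simp [hr k]
  have hD' : (fun k => Y k / Real.sqrt (α k)) ᵥ* Matrix.diagonal (fun k => Real.sqrt (α k)) = Y := by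
    ext k
    rw [Matrix.vecMul_diagonal]
    field_simp [hr k]
  rw [symGram, ← Matrix.mulVec_mulVec, Matrix.dotProduct_mulVec, hD', ← Matrix.mulVec_mulVec, hD,
    ← Matrix.mulVec_mulVec, ← Matrix.mulVec_mulVec, Matrix.dotProduct_mulVec]
  simp only [dotProduct, Matrix.mulVec_diagonal]
  simp only [dotProduct, Matrix.vecMul, Matrix.mulVec, Matrix.transpose_apply]
  refine Finset.sum_congr rfl fun k' _ => ?_
  have : ∑ k, Y k * R k k' = ∑ k, R k k' * Y k := Finset.sum_congr rfl fun k _ => mul_comm _ _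
  rw [this]; ring

lemma symGram_mulVec_of_eigen (hα : ∀ k, 0 < α k) {g : Fin K → ℝ} {μ : ℝ}
    (hg : affinityGram R α β *ᵥ g = μ • g) :
    symGram R α β *ᵥ (fun k => Real.sqrt (α k) * g k) = μ • fun k => Real.sqrt (α k) * g k := by
  have hD : Matrix.diagonal (fun k => Real.sqrt (α k)) *ᵥ g = fun k => Real.sqrt (α k) * g k := by
    ext k
    rw [Matrix.mulVec_diagonal]
  rw [← hD, Matrix.mulVec_mulVec, symGram, Matrix.mul_assoc, ← affinityGram_eq_mul_sqrt hα,
    ← Matrix.mulVec_mulVec, hg, Matrix.mulVec_smul]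

lemma alphaNorm_eq_one {y : Fin K → ℝ} (h : alphaNorm α y = 1) : ∑ k, α k * y k ^ 2 = 1 := by
  unfold alphaNorm at h
  rwa [Real.sqrt_eq_one] at h

/-- Conjugating `G` by `diag(√α)` gives a symmetric matrix with orthonormal eigenbasis `v`; then `φ
k = v k / √α` is orthonormal for the `α`-weighted product. Simplicity identifies each `lam l` with
one index `e l`, so `g l` is `φ (e l)` up to a sign. -/
theorem exists_spectral_resolution {L : ℕ} (hα : ∀ k, 0 < α k) (hβ : ∀ k', 0 < β k')
    (hL_rank : L ≤ (affinityGram R α β).rank) {lam : Fin L → ℝ}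
    (h_lam : AreLargestEigenvalues (affinityGram R α β) lam) {g : Fin L → Fin K → ℝ}
    (hg_eigen : ∀ l, affinityGram R α β *ᵥ g l = lam l • g l)
    (hg_norm : ∀ l, alphaNorm α (g l) = 1) :
    ∃ (φ : Fin K → Fin K → ℝ) (h : Fin K → ℝ) (e : Fin L → Fin K) (s : Fin L → ℝ),
      (∀ k m, ∑ j, α j * (φ k j * φ m j) = if k = m then 1 else 0) ∧
      (∀ Y : Fin K → ℝ, ∑ k', β k' * (∑ k, R k k' * Y k) ^ 2 = ∑ k, h k * (∑ j, φ k j * Y j) ^ 2) ∧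
      Function.Injective e ∧ (∀ l, s l = 1 ∨ s l = -1) ∧ (∀ l j, g l j = s l * φ (e l) j) ∧
      (∀ l, h (e l) = lam l) ∧ (∀ l, 0 < lam l) ∧ ∀ k, (∀ l, k ≠ e l) → ∀ l, h k < lam l := by
  classical
  set H := symGram R α β with hH
  have hHerm : H.IsHermitian := isHermitian_symGram
  set r : Fin K → ℝ := fun k => Real.sqrt (α k) with hr
  have hr0 : ∀ k, r k ≠ 0 := fun k => (Real.sqrt_pos.2 (hα k)).ne'
  have hrα : ∀ k, r k * r k = α k := fun k => Real.mul_self_sqrt (hα k).le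
  set v : Fin K → Fin K → ℝ := fun k => hHerm.eigenvectorBasis k with hv
  set h : Fin K → ℝ := hHerm.eigenvalues with hh
  have hvo : ∀ k m, v k ⬝ᵥ v m = if k = m then 1 else 0 := by
    intro k m
    have := orthonormal_iff_ite.1 hHerm.eigenvectorBasis.orthonormal m k
    rw [EuclideanSpace.inner_eq_star_dotProduct] at this
    simpa [eq_comm] using this
  have hparseval : ∀ x y : Fin K → ℝ, x ⬝ᵥ y = ∑ k, (v k ⬝ᵥ x) * (v k ⬝ᵥ y) := by
    intro x y
    have := hHerm.eigenvectorBasis.sum_inner_mul_inner (WithLp.toLp 2 x) (WithLp.toLp 2 y)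
    simp only [EuclideanSpace.inner_eq_star_dotProduct] at this
    simp only [star_trivial] at this
    rw [dotProduct_comm, ← this]
    refine Finset.sum_congr rfl fun k _ => ?_
    rw [dotProduct_comm y]
  have hvH : ∀ k x, v k ⬝ᵥ H *ᵥ x = h k * (v k ⬝ᵥ x) := by
    intro k x
    have h1 : H *ᵥ v k = h k • v k := hHerm.mulVec_eigenvectorBasis k
    have h2 : Hᵀ = H := by
      have := hHerm
      rwa [Matrix.IsHermitian, Matrix.conjTranspose_eq_transpose_of_trivial] at this
    rw [Matrix.dotProduct_mulVec, ← h2, Matrix.vecMul_transpose, h1, smul_dotProduct, smul_eq_mul]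
  have hcount : ∀ l, (Finset.univ.filter fun k => lam l = h k).card = 1 := by
    intro l
    have h1 := h_lam.simple l
    rw [← charpoly_symGram hα, ← Polynomial.count_roots, ← hH,
      hHerm.roots_charpoly_eq_eigenvalues, Multiset.count_map] at h1
    exact h1
  choose e he using fun l => Finset.card_eq_one.1 (hcount l)
  have he' : ∀ l k, lam l = h k ↔ k = e l := by
    intro l k
    have : k ∈ (Finset.univ.filter fun k => lam l = h k) ↔ k ∈ ({e l} : Finset (Fin K)) := by
      rw [he l]
    simpa using this
  have hroot : ∀ k, (∀ l, k ≠ e l) → ∀ l, h k < lam l := by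
    intro k hk
    have hr : (affinityGram R α β).charpoly.IsRoot (h k) := by
      rw [← charpoly_symGram hα]
      refine Polynomial.isRoot_of_mem_roots ?_
      rw [← hH, hHerm.roots_charpoly_eq_eigenvalues]
      exact Multiset.mem_map_of_mem _ (Finset.mem_univ_val k)
    rcases h_lam.largest _ hr with ⟨l, hl⟩ | hlt
    · exact absurd ((he' l k).1 hl.symm) (hk l)
    · exact hlt
  set φ : Fin K → Fin K → ℝ := fun k j => v k j / r j with hφ
  have hφo : ∀ k m, ∑ j, α j * (φ k j * φ m j) = if k = m then 1 else 0 := by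
    intro k m
    rw [← hvo k m]
    refine Finset.sum_congr rfl fun j _ => ?_
    rw [← hrα j]
    simp only [hφ]
    field_simp [hr0 j]
  have hform : ∀ Y : Fin K → ℝ,
      ∑ k', β k' * (∑ k, R k k' * Y k) ^ 2 = ∑ k, h k * (∑ j, φ k j * Y j) ^ 2 := by
    intro Y
    rw [← dotProduct_symGram Y hα, hparseval]
    refine Finset.sum_congr rfl fun k _ => ?_
    rw [hvH]
    have : v k ⬝ᵥ (fun k => Y k / Real.sqrt (α k)) = ∑ j, φ k j * Y j := by
      refine Finset.sum_congr rfl fun j _ => ?_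
      simp only [hφ, hr]; ring
    rw [this]; ring
  -- Evaluating the form at `Y = α φ m` isolates `h m` as a sum of nonnegative terms.
  have hh0 : ∀ k, 0 ≤ h k := by
    intro m
    have h1 := hform fun j => α j * φ m j
    have h2 : ∀ k, ∑ j, φ k j * (α j * φ m j) = if k = m then 1 else 0 := by
      intro k
      rw [← hφo k m]
      exact Finset.sum_congr rfl fun j _ => by ring
    simp only [h2, ite_pow, one_pow, ne_eq, OfNat.ofNat_ne_zero, not_false_eq_true, zero_pow,
      mul_ite, mul_one, mul_zero, Finset.sum_ite_eq', Finset.mem_univ, if_true] at h1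
    rw [← h1]
    exact Finset.sum_nonneg fun k' _ => mul_nonneg (hβ k').le (sq_nonneg _)
  -- If `lam l ≤ 0`, every nonzero eigenvalue is positive and so sits at some `e m` with `m ≠ l`.
  -- That leaves at most `L - 1` of them, fewer than the rank.
  have hpos : ∀ l, 0 < lam l := by
    intro l
    by_contra hl
    rw [not_lt] at hl
    have hsub : (Finset.univ.filter fun k => h k ≠ 0) ⊆ (Finset.univ.erase l).image e := by
      intro k hk
      have hk0 : h k ≠ 0 := (Finset.mem_filter.1 hk).2
      have hk1 : 0 < h k := lt_of_le_of_ne (hh0 k) hk0.symm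
      by_contra hnot
      have : ∀ m, k ≠ e m := by
        rintro m rfl
        refine hnot (Finset.mem_image_of_mem e (Finset.mem_erase.2 ⟨?_, Finset.mem_univ _⟩))
        rintro rfl
        have := (he' m (e m)).2 rfl
        linarith
      linarith [hroot k this l]
    have hc := (Finset.card_le_card hsub).trans Finset.card_image_le
    rw [Finset.card_erase_of_mem (Finset.mem_univ l), Finset.card_univ, Fintype.card_fin] at hc
    have hrank := hHerm.rank_eq_card_non_zero_eigs
    rw [Fintype.card_subtype] at hrank
    have := l.pos
    have hc' : (Finset.univ.filter fun k => h k ≠ 0).card = (affinityGram R α β).rank := by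
      rw [← rank_symGram hα]
      exact hrank.symm
    omega
  have hsig : ∀ l, ∃ s : ℝ, (s = 1 ∨ s = -1) ∧ ∀ j, g l j = s * φ (e l) j := by
    intro l
    set f : Fin K → ℝ := fun k => r k * g l k with hf
    have hfe : H *ᵥ f = lam l • f := symGram_mulVec_of_eigen hα (hg_eigen l)
    have hzero : ∀ k, k ≠ e l → v k ⬝ᵥ f = 0 := by
      intro k hk
      have h1 := hvH k f
      rw [hfe, dotProduct_smul, smul_eq_mul] at h1
      have h2 : lam l ≠ h k := fun hc => hk ((he' l k).1 hc)
      have h3 : (lam l - h k) * (v k ⬝ᵥ f) = 0 := by linarith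
      exact (mul_eq_zero.1 h3).resolve_left (sub_ne_zero.2 h2)
    refine ⟨v (e l) ⬝ᵥ f, ?_, fun j => ?_⟩
    · have h1 := hparseval f f
      rw [Finset.sum_eq_single (e l) (fun k _ hk => by rw [hzero k hk, zero_mul]) (by simp)] at h1
      have h2 : f ⬝ᵥ f = 1 := by
        rw [← alphaNorm_eq_one (hg_norm l)]
        refine Finset.sum_congr rfl fun j _ => ?_
        rw [← hrα j]; simp only [hf]; ring
      rw [h2] at h1
      exact mul_self_eq_one_iff.1 h1.symm
    · have h1 := hparseval (Pi.single j 1) f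
      rw [Finset.sum_eq_single (e l) (fun k _ hk => by rw [hzero k hk, mul_zero]) (by simp)] at h1
      rw [single_one_dotProduct, dotProduct_single_one] at h1
      simp only [hφ]
      have : g l j = f j / r j := by simp only [hf]; field_simp [hr0 j]
      rw [this, h1]; ring
  choose s hs1 hs2 using hsig
  refine ⟨φ, h, e, s, hφo, hform, fun l m hlm => ?_, hs1, hs2, fun l => ((he' l _).2 rfl).symm,
    hpos, hroot⟩
  refine h_lam.strictAnti.injective ?_
  rw [(he' l _).2 rfl, (he' m _).2 rfl, hlm]

/-- A uniform spectral gap below each of the top eigenvalues. -/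
lemma exists_gap {L : ℕ} {lam : Fin L → ℝ} (hanti : StrictAnti lam) {h : Fin K → ℝ}
    {e : Fin L → Fin K} (he : ∀ l, h (e l) = lam l) (hpos : ∀ l, 0 < lam l)
    (hlt : ∀ k, (∀ l, k ≠ e l) → ∀ l, h k < lam l) :
    ∃ θ > 0, (∀ l, θ ≤ h (e l)) ∧ ∀ l k, (∀ j ≤ l, k ≠ e j) → h k ≤ h (e l) - θ := by
  have hlt' : ∀ l k, (∀ j ≤ l, k ≠ e j) → h k < h (e l) := by
    intro l k hk
    rw [he l]
    by_cases hr : ∃ m, k = e m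
    · obtain ⟨m, rfl⟩ := hr
      rw [he m]
      refine hanti (lt_of_not_ge fun hml => hk m hml rfl)
    · push Not at hr
      exact hlt k hr l
  have h1 : ∀ᶠ θ : ℝ in 𝓝[>] 0, ∀ l, θ ≤ h (e l) := by
    refine eventually_all.2 fun l => ?_
    have : 0 < h (e l) := by rw [he]; exact hpos l
    exact (eventually_le_nhds this).filter_mono nhdsWithin_le_nhds
  have h2 : ∀ᶠ θ : ℝ in 𝓝[>] 0, ∀ l k, (∀ j ≤ l, k ≠ e j) → h k ≤ h (e l) - θ := by
    refine eventually_all.2 fun l => eventually_all.2 fun k => ?_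
    by_cases hk : ∀ j ≤ l, k ≠ e j
    · have := sub_pos.2 (hlt' l k hk)
      filter_upwards [(eventually_le_nhds this).filter_mono nhdsWithin_le_nhds] with θ hθ _
      linarith
    · exact Eventually.of_forall fun θ hc => absurd hc hk
  obtain ⟨θ, h3, h4, h5⟩ := ((h1.and (h2.and self_mem_nhdsWithin))).exists
  exact ⟨θ, h5, h3, h4⟩

end Spectral

/-! ### From small noise to recovery of the classes. -/

section Model

lemma HasClassFractions.sum_comp {n K : ℕ} {c : Fin n → Fin K} {a : Fin K → ℝ}
    (h : HasClassFractions c a) (f : Fin K → ℝ) : ∑ u, f (c u) = n * ∑ k, a k * f k := by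
  rw [← Finset.sum_fiberwise Finset.univ c, Finset.mul_sum]
  refine Finset.sum_congr rfl fun k _ => ?_
  rw [Finset.sum_congr rfl (g := fun _ => f k) fun u hu => by rw [(Finset.mem_filter.1 hu).2],
    Finset.sum_const, nsmul_eq_mul, h k]
  ring

lemma sum_mul_sum_fiber {n K : ℕ} (c : Fin n → Fin K) (f : Fin K → ℝ) (y : Fin n → ℝ) :
    ∑ k, f k * ∑ u with c u = k, y u = ∑ u, f (c u) * y u := by
  rw [← Finset.sum_fiberwise Finset.univ c]
  refine Finset.sum_congr rfl fun k _ => ?_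
  rw [Finset.mul_sum]
  exact Finset.sum_congr rfl fun u hu => by rw [(Finset.mem_filter.1 hu).2]

/-- The vector of users whose coordinates depend on the class only, normalised. -/
noncomputable def classVector {N K : ℕ} (c : Fin N → Fin K) (φ : Fin K → ℝ) :
    EuclideanSpace ℝ (Fin N) :=
  WithLp.toLp 2 fun u => φ (c u) / Real.sqrt N

lemma real_inner_eq_sum {N : ℕ} (x y : EuclideanSpace ℝ (Fin N)) :
    inner ℝ x y = ∑ u, x u * y u := by
  rw [PiLp.inner_apply]
  exact Finset.sum_congr rfl fun u _ => by simp [mul_comm]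

variable {N F K K' : ℕ} {α : Fin K → ℝ} {β : Fin K' → ℝ} {kU : Fin N → Fin K} {kI : Fin F → Fin K'}

lemma orthonormal_classVector (hN : 0 < N) (hU : HasClassFractions kU α)
    {φ : Fin K → Fin K → ℝ}
    (hφ : ∀ k m, ∑ j, α j * (φ k j * φ m j) = if k = m then 1 else 0) :
    Orthonormal ℝ fun k => classVector kU (φ k) := by
  have hN' : (0 : ℝ) < N := by exact_mod_cast hN
  rw [orthonormal_iff_ite]
  intro k m
  rw [real_inner_eq_sum, ← hφ k m]
  have h1 := hU.sum_comp fun j => φ k j * φ m j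
  calc ∑ u, classVector kU (φ k) u * classVector kU (φ m) u
      = ∑ u, φ k (kU u) * φ m (kU u) / N := by
        refine Finset.sum_congr rfl fun u _ => ?_
        simp only [classVector]
        rw [div_mul_div_comm, Real.mul_self_sqrt hN'.le]
    _ = _ := by
        rw [← Finset.sum_div, h1]
        field_simp

/-- The quadratic form of the expected rating matrix. -/
lemma sum_sq_mean_eq (hN : 0 < N) {γ : ℝ} (hF : (F : ℝ) = γ * N)
    (hI : HasClassFractions kI β) {R : Matrix (Fin K) (Fin K') ℝ} {φ : Fin K → Fin K → ℝ}
    {h : Fin K → ℝ}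
    (hform : ∀ Y : Fin K → ℝ,
      ∑ k', β k' * (∑ k, R k k' * Y k) ^ 2 = ∑ k, h k * (∑ j, φ k j * Y j) ^ 2)
    (ω : ℝ) (y : EuclideanSpace ℝ (Fin N)) :
    ∑ i, (∑ u, ω / N * R (kU u) (kI i) * y u) ^ 2 =
      ∑ k, ω ^ 2 * γ * h k * inner ℝ (classVector kU (φ k)) y ^ 2 := by
  have hN' : (0 : ℝ) < N := by exact_mod_cast hN
  -- The mean matrix sees `y` only through its sums over the user classes.
  have h1 := hform fun k => ∑ u with kU u = k, y u
  simp only [sum_mul_sum_fiber kU (fun k => R k _), sum_mul_sum_fiber kU (φ _)] at h1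
  have h2 := hI.sum_comp fun k' => (∑ u, R (kU u) k' * y u) ^ 2
  have h3 : ∀ k, inner ℝ (classVector kU (φ k)) y = (∑ u, φ k (kU u) * y u) / Real.sqrt N := by
    intro k
    rw [real_inner_eq_sum, Finset.sum_div]
    refine Finset.sum_congr rfl fun u _ => ?_
    simp only [classVector]; ring
  simp only [h3, div_pow, Real.sq_sqrt hN'.le]
  calc ∑ i, (∑ u, ω / N * R (kU u) (kI i) * y u) ^ 2
      = ∑ i, (ω / N) ^ 2 * (∑ u, R (kU u) (kI i) * y u) ^ 2 := by
        refine Finset.sum_congr rfl fun i _ => ?_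
        rw [← mul_pow, Finset.mul_sum]
        simp only [mul_assoc]
    _ = (ω / N) ^ 2 * (F * ∑ k, h k * (∑ u, φ k (kU u) * y u) ^ 2) := by
        rw [← Finset.mul_sum, h2, h1]
    _ = _ := by
        rw [hF, Finset.mul_sum, Finset.mul_sum]
        refine Finset.sum_congr rfl fun k _ => ?_
        field_simp

/-- The columns of a matrix as Euclidean vectors. -/
def euclideanCol (X : Matrix (Fin N) (Fin F) ℝ) (j : Fin F) : EuclideanSpace ℝ (Fin N) :=
  WithLp.toLp 2 fun u => X u j

lemma IsSVD.orthonormal {A X : Matrix (Fin N) (Fin F) ℝ} {σ : Fin F → ℝ}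
    {Y : Matrix (Fin F) (Fin F) ℝ} (h : IsSVD A X σ Y) : Orthonormal ℝ (euclideanCol X) := by
  rw [orthonormal_iff_ite]
  intro i j
  have h1 := congrFun (congrFun h.left_orth i) j
  rw [Matrix.mul_apply, Matrix.one_apply] at h1
  rw [real_inner_eq_sum, ← h1]
  rfl

lemma IsSVD.sum_sq_eq {A X : Matrix (Fin N) (Fin F) ℝ} {σ : Fin F → ℝ}
    {Y : Matrix (Fin F) (Fin F) ℝ} (h : IsSVD A X σ Y) (y : EuclideanSpace ℝ (Fin N)) :
    ∑ i, (∑ u, A u i * y u) ^ 2 = ∑ j, σ j ^ 2 * inner ℝ (euclideanCol X j) y ^ 2 := by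
  set z : Fin F → ℝ := fun j => σ j * inner ℝ (euclideanCol X j) y with hz
  have h1 : y.ofLp ᵥ* A = z ᵥ* Y := by
    rw [h.eq_mul, ← Matrix.vecMul_vecMul, ← Matrix.vecMul_vecMul]
    congr 1
    ext j
    rw [Matrix.vecMul_diagonal, hz]
    simp only [real_inner_eq_sum, Matrix.vecMul, dotProduct, euclideanCol]
    rw [mul_comm]
    congr 1
    exact Finset.sum_congr rfl fun u _ => mul_comm _ _
  have h2 : (z ᵥ* Y) ⬝ᵥ (z ᵥ* Y) = z ⬝ᵥ z := by
    rw [← Matrix.mulVec_transpose Y z, Matrix.dotProduct_mulVec, Matrix.mulVec_transpose,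
      Matrix.vecMul_vecMul, h.right_orth, Matrix.vecMul_one]
  calc ∑ i, (∑ u, A u i * y u) ^ 2 = (y.ofLp ᵥ* A) ⬝ᵥ (y.ofLp ᵥ* A) := by
        refine Finset.sum_congr rfl fun i _ => ?_
        have : (y.ofLp ᵥ* A) i = ∑ u, A u i * y u := by
          simp only [Matrix.vecMul, dotProduct]
          exact Finset.sum_congr rfl fun u _ => mul_comm _ _
        rw [this, sq]
    _ = z ⬝ᵥ z := by rw [h1, h2]
    _ = _ := Finset.sum_congr rfl fun j _ => by simp only [hz]; ring

lemma norm_sq_eq_sum (y : EuclideanSpace ℝ (Fin N)) : ‖y‖ ^ 2 = ∑ u, y u ^ 2 := by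
  rw [EuclideanSpace.norm_sq_eq]
  simp

/-- The adjoint of a matrix with small bilinear form is small in operator norm. -/
lemma sum_sq_le_of_bilinear_le {W : Matrix (Fin N) (Fin F) ℝ} {κ : ℝ}
    (h : ∀ (x : Fin N → ℝ) (y : Fin F → ℝ), ∑ u, x u ^ 2 ≤ 1 → ∑ i, y i ^ 2 ≤ 1 →
      ∑ u, ∑ i, x u * (W u i * y i) ≤ κ) {x : Fin N → ℝ} (hx : ∑ u, x u ^ 2 ≤ 1) :
    ∑ i, (∑ u, W u i * x u) ^ 2 ≤ κ ^ 2 := by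
  set z : Fin F → ℝ := fun i => ∑ u, W u i * x u with hz
  set n := Real.sqrt (∑ i, z i ^ 2) with hn
  have hn2 : n ^ 2 = ∑ i, z i ^ 2 := Real.sq_sqrt (Finset.sum_nonneg fun i _ => sq_nonneg _)
  change ∑ i, z i ^ 2 ≤ κ ^ 2
  rw [← hn2]
  rcases (Real.sqrt_nonneg (∑ i, z i ^ 2)).eq_or_lt with h0 | h0
  · have hn0 : n = 0 := h0.symm
    rw [hn0]
    simpa using sq_nonneg κ
  · have h1 := h x (fun i => z i / n) hx (by
      simp only [div_pow]
      rw [← Finset.sum_div, ← hn2, div_self (pow_pos h0 2).ne'])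
    have h2 : ∑ u, ∑ i, x u * (W u i * (z i / n)) = n := by
      rw [Finset.sum_comm]
      calc ∑ i, ∑ u, x u * (W u i * (z i / n)) = ∑ i, z i ^ 2 / n := by
            refine Finset.sum_congr rfl fun i _ => ?_
            rw [sq, mul_div_assoc]
            nth_rewrite 2 [hz]
            rw [Finset.sum_mul]
            exact Finset.sum_congr rfl fun u _ => by ring
        _ = n := by
            rw [← Finset.sum_div, ← hn2, sq, mul_div_assoc, div_self h0.ne', mul_one]
    rw [h2] at h1
    exact pow_le_pow_left₀ h0.le h1 2

lemma sum_sq_le_of_entries {M : Matrix (Fin N) (Fin F) ℝ} {ω : ℝ} (hN : 0 < N) (hF : F ≤ N)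
    (hω : 0 ≤ ω) (hM : ∀ u i, |M u i| ≤ ω / N) {x : Fin N → ℝ} (hx : ∑ u, x u ^ 2 ≤ 1) :
    ∑ i, (∑ u, M u i * x u) ^ 2 ≤ ω ^ 2 := by
  have hN' : (0 : ℝ) < N := by exact_mod_cast hN
  have hF' : (F : ℝ) ≤ N := by exact_mod_cast hF
  refine sum_sq_le_of_bilinear_le (fun x y hx hy => ?_) hx
  refine (le_abs_self _).trans ((abs_bilinear_le hM x y).trans ?_)
  have h1 := sum_abs_le_sqrt hx (n := N) (by simp)
  have h2 := sum_abs_le_sqrt hy (n := N) (by simpa using hF)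
  calc ω / N * ((∑ u, |x u|) * ∑ i, |y i|) ≤ ω / N * (Real.sqrt N * Real.sqrt N) := by
        gcongr
    _ = ω := by rw [Real.mul_self_sqrt hN'.le]; field_simp

/-- Expanding `a = m + (a - m)`, the error is at most `(κ² + 2κ) ω²`, and `κ ≤ 1` gives the `3`. -/
lemma abs_sum_sq_sub_le {ι : Type*} [Fintype ι] {a m : ι → ℝ} {κ ω : ℝ} (hκ : 0 ≤ κ) (hκ1 : κ ≤ 1)
    (hω : 0 ≤ ω) (hm : ∑ i, m i ^ 2 ≤ ω ^ 2) (hw : ∑ i, (a i - m i) ^ 2 ≤ (κ * ω) ^ 2) :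
    |∑ i, m i ^ 2 - ∑ i, a i ^ 2| ≤ 3 * κ * ω ^ 2 := by
  have h1 : ∑ i, a i ^ 2 = ∑ i, m i ^ 2 + ∑ i, (a i - m i) ^ 2 + 2 * ∑ i, (a i - m i) * m i := by
    rw [Finset.mul_sum, ← Finset.sum_add_distrib, ← Finset.sum_add_distrib]
    exact Finset.sum_congr rfl fun i _ => by ring
  have h2 : |∑ i, (a i - m i) * m i| ≤ κ * ω * ω := by
    refine abs_le_of_sq_le_sq ?_ (by positivity)
    refine (Finset.sum_mul_sq_le_sq_mul_sq _ _ _).trans ?_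
    rw [mul_pow]
    exact mul_le_mul hw hm (Finset.sum_nonneg fun _ _ => sq_nonneg _) (sq_nonneg _)
  have h3 : 0 ≤ ∑ i, (a i - m i) ^ 2 := Finset.sum_nonneg fun _ _ => sq_nonneg _
  have h4 : (κ * ω) ^ 2 ≤ κ * ω ^ 2 := by
    rw [mul_pow]
    refine mul_le_mul_of_nonneg_right ?_ (sq_nonneg _)
    nlinarith
  have h5 := abs_le.1 h2
  rw [abs_le]
  constructor <;> nlinarith

/-- Two unit vectors are close, up to sign, if their inner product is close to one. -/
lemma exists_sign_norm_sub_sq_le {x v : EuclideanSpace ℝ (Fin N)} (hx : ‖x‖ = 1) (hv : ‖v‖ = 1)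
    {ξ : ℝ} (h : 1 - inner ℝ v x ^ 2 ≤ ξ) :
    ∃ t : ℝ, (t = 1 ∨ t = -1) ∧ ‖t • x - v‖ ^ 2 ≤ 2 * ξ := by
  have h1 : |inner ℝ v x| ≤ 1 := by
    have := abs_real_inner_le_norm v x
    rwa [hx, hv, one_mul] at this
  have h2 : ∀ t : ℝ, (t = 1 ∨ t = -1) → ‖t • x - v‖ ^ 2 = 2 - 2 * (t * inner ℝ v x) := by
    intro t ht
    have ht' : ‖t • x‖ = 1 := by
      rw [norm_smul, hx]
      rcases ht with rfl | rfl <;> simp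
    rw [norm_sub_sq_real, ht', hv, real_inner_smul_left, real_inner_comm]
    ring
  -- With the right sign the squared distance is `2 - 2|c|` for `c = ⟪v, x⟫`, and `c² ≤ |c|` bounds
  -- this by `2(1 - c²)`.
  have h3 : |inner ℝ v x| ^ 2 ≤ |inner ℝ v x| := by
    nlinarith [abs_nonneg (inner ℝ v x)]
  rw [sq_abs] at h3
  rcases le_total 0 (inner ℝ v x) with h0 | h0
  · refine ⟨1, Or.inl rfl, ?_⟩
    rw [h2 1 (Or.inl rfl)]
    rw [abs_of_nonneg h0] at h3
    linarith
  · refine ⟨-1, Or.inr rfl, ?_⟩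
    rw [h2 (-1) (Or.inr rfl)]
    rw [abs_of_nonpos h0] at h3
    linarith

/-- If the mean square distance is small, then most points are close. -/
lemma ncard_close_ge {E : Type*} [SeminormedAddCommGroup E] (d : Fin N → E) {ε : ℝ} (hε : 0 < ε)
    (h : ∑ u, ‖d u‖ ^ 2 ≤ ε ^ 3 * N) : (1 - ε) * N ≤ ({u : Fin N | ‖d u‖ ≤ ε}.ncard : ℝ) := by
  have h1 : ((Finset.univ.filter fun u => ¬ ‖d u‖ ≤ ε).card : ℝ) * ε ^ 2 ≤ ε ^ 3 * N := by
    calc ((Finset.univ.filter fun u => ¬ ‖d u‖ ≤ ε).card : ℝ) * ε ^ 2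
        = ∑ u with ¬ ‖d u‖ ≤ ε, ε ^ 2 := by simp
      _ ≤ ∑ u with ¬ ‖d u‖ ≤ ε, ‖d u‖ ^ 2 := by
          refine Finset.sum_le_sum fun u hu => ?_
          have := not_le.1 (Finset.mem_filter.1 hu).2
          gcongr
      _ ≤ ∑ u, ‖d u‖ ^ 2 := Finset.sum_le_sum_of_subset_of_nonneg (Finset.filter_subset _ _)
          fun _ _ _ => sq_nonneg _
      _ ≤ _ := h
  have h2 : ((Finset.univ.filter fun u => ¬ ‖d u‖ ≤ ε).card : ℝ) ≤ ε * N := by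
    have h3 : ε ^ 3 * N = (ε * N) * ε ^ 2 := by ring
    rw [h3] at h1
    exact le_of_mul_le_mul_right h1 (by positivity)
  have h4 : ({u : Fin N | ‖d u‖ ≤ ε}.ncard) = (Finset.univ.filter fun u => ‖d u‖ ≤ ε).card := by
    rw [← Set.ncard_coe_finset]
    congr 1
    ext u; simp
  have h5 := Finset.card_filter_add_card_filter_not (s := Finset.univ) fun u => ‖d u‖ ≤ ε
  rw [Finset.card_univ, Fintype.card_fin] at h5
  have h6 : ((Finset.univ.filter fun u => ‖d u‖ ≤ ε).card : ℝ) +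
      (Finset.univ.filter fun u => ¬ ‖d u‖ ≤ ε).card = N := by exact_mod_cast h5
  rw [h4]
  linarith

/-- Recovery of the classes from the top singular vectors when the noise is small in operator
norm. -/
theorem exists_signs_of_noise_le {L : ℕ} {γ : ℝ} (hγ : 0 < γ) (hγ1 : γ < 1) (hN : 0 < N)
    (hF : (F : ℝ) = γ * N) (hU : HasClassFractions kU α) (hI : HasClassFractions kI β)
    {R : Matrix (Fin K) (Fin K') ℝ} (hR : ∀ k k', 0 ≤ R k k' ∧ R k k' ≤ 1)
    {φ : Fin K → Fin K → ℝ} {h : Fin K → ℝ} {e : Fin L → Fin K} {s : Fin L → ℝ}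
    {g : Fin L → Fin K → ℝ}
    (hφ : ∀ k m, ∑ j, α j * (φ k j * φ m j) = if k = m then 1 else 0)
    (hform : ∀ Y : Fin K → ℝ,
      ∑ k', β k' * (∑ k, R k k' * Y k) ^ 2 = ∑ k, h k * (∑ j, φ k j * Y j) ^ 2)
    (he : Function.Injective e) (hs : ∀ l, s l = 1 ∨ s l = -1)
    (hg : ∀ l j, g l j = s l * φ (e l) j) (hanti : Antitone (h ∘ e)) {θ : ℝ} (hθ : 0 < θ)
    (hθ1 : ∀ l, θ ≤ h (e l)) (hθ2 : ∀ l k, (∀ j ≤ l, k ≠ e j) → h k ≤ h (e l) - θ)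
    {ω κ ε : ℝ} (hω : 0 < ω) (hκ : 0 ≤ κ) (hκ1 : κ ≤ 1) (hε : 0 < ε)
    (hκε : 24 * L ^ 2 * κ ≤ ε ^ 3 * (γ * θ)) {A : Matrix (Fin N) (Fin F) ℝ}
    (hA : ∀ (x : Fin N → ℝ) (y : Fin F → ℝ), ∑ u, x u ^ 2 ≤ 1 → ∑ i, y i ^ 2 ≤ 1 →
      ∑ u, ∑ i, x u * ((A u i - ω / N * R (kU u) (kI i)) * y i) ≤ κ * ω)
    {x : Fin L → Fin N → ℝ} (hx : AreTopLeftSingularVectors A x) :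
    ∃ t : Fin L → ℝ, (∀ l, t l = 1 ∨ t l = -1) ∧
      (1 - ε) * N ≤ ({u : Fin N | ‖Real.sqrt N • coordRow (fun l => t l • x l) u -
        coordRow g (kU u)‖ ≤ ε}.ncard : ℝ) := by
  obtain ⟨X, σ, Y, hsvd, hLF, hxX⟩ := hx
  have hN' : (0 : ℝ) < N := by exact_mod_cast hN
  have hFN : F ≤ N := by
    have : (F : ℝ) ≤ N := by rw [hF]; nlinarith
    exact_mod_cast this
  have hV := orthonormal_classVector hN hU hφ
  have hX := hsvd.orthonormal
  have hM : ∀ u i, |ω / N * R (kU u) (kI i)| ≤ ω / N := by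
    intro u i
    rw [abs_of_nonneg (mul_nonneg (by positivity) (hR _ _).1)]
    exact mul_le_of_le_one_right (by positivity) (hR _ _).2
  have hdiff : ∀ y : EuclideanSpace ℝ (Fin N), ‖y‖ = 1 →
      |∑ k, ω ^ 2 * γ * h k * inner ℝ (classVector kU (φ k)) y ^ 2 -
        ∑ i, σ i ^ 2 * inner ℝ (euclideanCol X i) y ^ 2| ≤ 3 * κ * ω ^ 2 := by
    intro y hy
    have hy' : ∑ u, y u ^ 2 ≤ 1 := by rw [← norm_sq_eq_sum, hy]; norm_num
    rw [← sum_sq_mean_eq hN hF hI hform, ← hsvd.sum_sq_eq]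
    refine abs_sum_sq_sub_le hκ hκ1 hω.le (sum_sq_le_of_entries
      (M := fun u i => ω / N * R (kU u) (kI i)) hN hFN hω.le hM hy') ?_
    have := sum_sq_le_of_bilinear_le (W := fun u i => A u i - ω / N * R (kU u) (kI i)) hA hy'
    refine le_of_eq_of_le (Finset.sum_congr rfl fun i _ => ?_) this
    rw [← Finset.sum_sub_distrib]
    congr 1
    exact Finset.sum_congr rfl fun u _ => by ring
  have hωγ : 0 < ω ^ 2 * γ := by positivity
  have hoverlap := gap_mul_one_sub_sq_inner_le hV hX (a := fun k => ω ^ 2 * γ * h k)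
    (b := fun i => σ i ^ 2) (fun i j hij => pow_le_pow_left₀ (hsvd.nonneg _) (hsvd.antitone hij) 2)
    (fun i => sq_nonneg _) hdiff hLF he (θ := ω ^ 2 * γ * θ) (by positivity)
    (fun l => mul_le_mul_of_nonneg_left (hθ1 l) hωγ.le)
    (fun l m hlm => mul_le_mul_of_nonneg_left (hanti hlm) hωγ.le)
    (fun l k hk => by
      rw [← mul_sub]
      exact mul_le_mul_of_nonneg_left (hθ2 l k hk) hωγ.le)
  -- Perturbation `3κω²` times `4L`, over the gap `ω²γθ`: the powers of `ω` cancel.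
  set ξ := 12 * L * κ / (γ * θ) with hξ
  have hclose : ∀ l, ∃ t : ℝ, (t = 1 ∨ t = -1) ∧
      ‖t • euclideanCol X (Fin.castLE hLF l) - classVector kU (φ (e l))‖ ^ 2 ≤ 2 * ξ := by
    intro l
    refine exists_sign_norm_sub_sq_le (hX.1 _) (hV.1 _) ?_
    rw [hξ, le_div_iff₀ (by positivity)]
    have := hoverlap l
    refine le_of_mul_le_mul_left ?_ (show 0 < ω ^ 2 by positivity)
    linarith
  choose t ht1 ht2 using hclose
  -- `t l` aligns the singular vector with `φ (e l)`, and `s l` turns `φ (e l)` into `g l`.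
  refine ⟨fun l => s l * t l, fun l => ?_, ncard_close_ge _ hε ?_⟩
  · rcases hs l with h1 | h1 <;> rcases ht1 l with h2 | h2 <;> simp [h1, h2]
  have hsq : ∀ l, s l ^ 2 = 1 := fun l => by rcases hs l with h1 | h1 <;> simp [h1]
  have hsN : Real.sqrt N ≠ 0 := (Real.sqrt_pos.2 hN').ne'
  calc ∑ u, ‖Real.sqrt N • coordRow (fun l => (s l * t l) • x l) u - coordRow g (kU u)‖ ^ 2
      = ∑ u, ∑ l, N * (t l • euclideanCol X (Fin.castLE hLF l) -
          classVector kU (φ (e l))) u ^ 2 := by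
        refine Finset.sum_congr rfl fun u _ => ?_
        rw [norm_sq_eq_sum]
        refine Finset.sum_congr rfl fun l _ => ?_
        have h1 : (Real.sqrt N • coordRow (fun l => (s l * t l) • x l) u - coordRow g (kU u)) l =
            s l * Real.sqrt N * (t l • euclideanCol X (Fin.castLE hLF l) -
              classVector kU (φ (e l))) u := by
          simp only [coordRow, euclideanCol, classVector, PiLp.sub_apply, PiLp.smul_apply,
            Pi.smul_apply, smul_eq_mul, hg, hxX]
          field_simp
        rw [h1, mul_pow, mul_pow, hsq, Real.sq_sqrt hN'.le, one_mul]
    _ = ∑ l, N * ‖t l • euclideanCol X (Fin.castLE hLF l) - classVector kU (φ (e l))‖ ^ 2 := by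
        rw [Finset.sum_comm]
        refine Finset.sum_congr rfl fun l _ => ?_
        rw [norm_sq_eq_sum, Finset.mul_sum]
    _ ≤ ∑ _l : Fin L, N * (2 * ξ) :=
        Finset.sum_le_sum fun l _ => mul_le_mul_of_nonneg_left (ht2 l) hN'.le
    _ = (24 * L ^ 2 * κ / (γ * θ)) * N := by
        rw [Finset.sum_const, Finset.card_univ, Fintype.card_fin, nsmul_eq_mul, hξ]; ring
    _ ≤ ε ^ 3 * N := by
        refine mul_le_mul_of_nonneg_right ?_ hN'.le
        rwa [div_le_iff₀ (by positivity)]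

end Model

/-! ### Choice of constants and of the error sequences. -/

lemma exists_seq_of_eventually {p : ℕ → ℝ → Prop} (h1 : ∀ N, p N 1)
    (h : ∀ ε, 0 < ε → ∀ᶠ N in atTop, p N ε) :
    ∃ ε : ℕ → ℝ, Tendsto ε atTop (𝓝 0) ∧ ∀ N, p N (ε N) := by
  classical
  -- A diagonal choice: the best precision `1 / (m + 1)` with `m ≤ N` that works at `N`. The default
  -- `m = 0` is precision `1`, covered by `h1`.
  set n : ℕ → ℕ := fun N => Nat.findGreatest (fun m => p N (1 / ((m : ℝ) + 1))) N with hn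
  have htop : Tendsto n atTop atTop := by
    refine tendsto_atTop.2 fun m => ?_
    filter_upwards [h (1 / ((m : ℝ) + 1)) (by positivity), eventually_ge_atTop m] with N hN hm
    exact Nat.le_findGreatest hm hN
  refine ⟨fun N => 1 / ((n N : ℝ) + 1), tendsto_one_div_add_atTop_nhds_zero_nat.comp htop,
    fun N => ?_⟩
  exact Nat.findGreatest_spec (P := fun m => p N (1 / ((m : ℝ) + 1))) (Nat.zero_le N)
    (by simpa using h1 N)

/-- For `N` users, with probability at least `1 - ε` the singular vectors recover the classes of
all but a fraction `ε` of the users up to an error `ε`. -/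
def RecoversClasses {K K' L : ℕ} (α : Fin K → ℝ) (β : Fin K' → ℝ) (γ : ℝ)
    (R : Matrix (Fin K) (Fin K') ℝ) (ω : ℕ → ℝ) (g : Fin L → Fin K → ℝ) (N : ℕ) (ε : ℝ) : Prop :=
  ∀ F : ℕ, (F : ℝ) = γ * N →
    ∀ (kU : Fin N → Fin K) (kI : Fin F → Fin K'), HasClassFractions kU α → HasClassFractions kI β →
    ∀ (Ω : Type*) [MeasurableSpace Ω] (P : Measure Ω) [IsProbabilityMeasure P]
      (S : Ω → Matrix (Fin N) (Fin F) ℝ),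
      IsBernoulliMatrix P S (fun u i => ω N / N * R (kU u) (kI i)) →
      1 - ε ≤ P.real {w | ∀ x : Fin L → Fin N → ℝ, AreTopLeftSingularVectors (S w) x →
        ∃ s : Fin L → ℝ, (∀ l, s l = 1 ∨ s l = -1) ∧
          (1 - ε) * N ≤ ({u : Fin N | ‖Real.sqrt N • coordRow (fun l => s l • x l) u -
            coordRow g (kU u)‖ ≤ ε}.ncard : ℝ)}

/-- Choice of the constants in the operator norm bound for the noise. -/
lemma exists_noise_constants {C κ : ℝ} (hC : 0 < C) (hκ : 0 < κ) :
    ∃ δ B ε : ℝ, 0 < δ ∧ 0 < B ∧ 0 < ε ∧ ε ≤ 1 ∧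
      2 ≤ Real.exp (-((2 / C + 1) / δ)) * B ^ 2 ∧
      B ^ 2 * ε + 4 * Real.sqrt (2 * δ * (2 + 2 / C)) + 2 / B ≤ κ := by
  set D := 2 + 2 / C with hD
  have hD0 : 0 < D := by positivity
  -- The three error terms receive `κ / 3` each. The order is forced: `δ` determines the block size
  -- `η`, which bounds `B` from below, and `ε` must be small compared with `1 / B²`.
  set δ := (κ / 12) ^ 2 / (2 * D) with hδ
  have hδ0 : 0 < δ := by positivity
  set η := Real.exp (-((2 / C + 1) / δ)) with hη
  have hη0 : 0 < η := Real.exp_pos _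
  set B := max (6 / κ) (Real.sqrt (2 / η)) with hB
  have hB0 : 0 < B := lt_of_lt_of_le (by positivity) (le_max_left _ _)
  refine ⟨δ, B, min 1 (κ / 3 / B ^ 2), hδ0, hB0, lt_min one_pos (by positivity), min_le_left _ _,
    ?_, ?_⟩
  · have h1 : 2 / η ≤ B ^ 2 := by
      rw [← Real.sq_sqrt (show 0 ≤ 2 / η by positivity)]
      exact pow_le_pow_left₀ (Real.sqrt_nonneg _) (le_max_right _ _) 2
    calc (2 : ℝ) = η * (2 / η) := by field_simp
      _ ≤ η * B ^ 2 := by gcongr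
  · have h1 : B ^ 2 * min 1 (κ / 3 / B ^ 2) ≤ κ / 3 := by
      calc B ^ 2 * min 1 (κ / 3 / B ^ 2) ≤ B ^ 2 * (κ / 3 / B ^ 2) := by
            gcongr; exact min_le_right _ _
        _ = κ / 3 := by field_simp
    have h2 : Real.sqrt (2 * δ * D) = κ / 12 := by
      rw [show 2 * δ * D = (κ / 12) ^ 2 by rw [hδ]; field_simp, Real.sqrt_sq (by positivity)]
    have h3 : 2 / B ≤ κ / 3 := by
      rw [div_le_iff₀ hB0]
      calc (2 : ℝ) = κ / 3 * (6 / κ) := by field_simp; norm_num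
        _ ≤ κ / 3 * B := by gcongr; exact le_max_left _ _
    rw [h2]; linarith

theorem eventually_recoversClasses {K K' L : ℕ} {α : Fin K → ℝ} (hα : ∀ k, 0 < α k)
    {β : Fin K' → ℝ} (hβ : ∀ k', 0 < β k') {γ : ℝ} (hγ_pos : 0 < γ) (hγ_lt : γ < 1)
    {R : Matrix (Fin K) (Fin K') ℝ} (hR : ∀ k k', 0 ≤ R k k' ∧ R k k' ≤ 1)
    {ω : ℕ → ℝ} (hω_top : Tendsto ω atTop atTop) (hL_rank : L ≤ (affinityGram R α β).rank)
    {lam : Fin L → ℝ} (h_lam : AreLargestEigenvalues (affinityGram R α β) lam)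
    {g : Fin L → Fin K → ℝ} (hg_eigen : ∀ l, affinityGram R α β *ᵥ g l = lam l • g l)
    (hg_norm : ∀ l, alphaNorm α (g l) = 1) {C : ℝ} (hC : 0 < C)
    (hω_log : ∀ᶠ N : ℕ in atTop, C * Real.log N ≤ ω N) {ε : ℝ} (hε : 0 < ε) :
    ∀ᶠ N in atTop, RecoversClasses α β γ R ω g N ε := by
  obtain ⟨φ, h, e, s, hφ, hform, he, hs, hg, hlam, hpos, hlt⟩ :=
    exists_spectral_resolution hα hβ hL_rank h_lam hg_eigen hg_norm
  obtain ⟨θ, hθ, hθ1, hθ2⟩ := exists_gap h_lam.strictAnti hlam hpos hlt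
  -- The `+ 1` keeps the denominator positive when `L = 0`.
  set κ := min 1 (ε ^ 3 * (γ * θ) / (24 * L ^ 2 + 1)) with hκ
  have hκ0 : 0 < κ := lt_min one_pos (by positivity)
  have hκε : 24 * L ^ 2 * κ ≤ ε ^ 3 * (γ * θ) := by
    have h1 : κ ≤ ε ^ 3 * (γ * θ) / (24 * L ^ 2 + 1) := min_le_right _ _
    rw [le_div_iff₀ (by positivity)] at h1
    linarith
  obtain ⟨δ, B, ε', hδ, hB, hε', hε'1, hηB, hconst⟩ := exists_noise_constants hC hκ0
  filter_upwards [eventually_isQuasirandom hC hω_top hω_log hε' hε'1 hδ hε,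
    hω_top.eventually_gt_atTop 0, eventually_gt_atTop 0] with N hquasi hω hN
  intro F hF kU kI hU hI Ω _ P _ S hS
  have hFN : F ≤ N := by
    have : (F : ℝ) ≤ N := by rw [hF]; exact mul_le_of_le_one_left (Nat.cast_nonneg _) hγ_lt.le
    exact_mod_cast this
  have hq0 : ∀ u i, 0 ≤ ω N / N * R (kU u) (kI i) := fun u i =>
    mul_nonneg (by positivity) (hR _ _).1
  have hq : ∀ u i, ω N / N * R (kU u) (kI i) ≤ ω N / N := fun u i =>
    mul_le_of_le_one_right (by positivity) (hR _ _).2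
  refine (hquasi F hFN Ω P S _ hS hq0 hq).trans (measureReal_mono (fun w hw x hx => ?_)
    (measure_ne_top P _))
  refine exists_signs_of_noise_le hγ_pos hγ_lt hN hF hU hI hR hφ hform he hs hg ?_ hθ hθ1 hθ2 hω
    hκ0.le (min_le_left _ _) hε hκε (fun y z hy hz => ?_) hx
  · intro l m hlm
    simp only [Function.comp_apply, hlam]
    exact h_lam.strictAnti.antitone hlm
  · have hA0 : ∀ u i, 0 ≤ S w u i := fun u i => by
      rcases hS.zero_or_one w u i with h | h <;> simp [h]
    refine (hw.bilinear_le hA0 hN hFN hω.le hδ.le (by positivity) hB hηB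
      (fun u i => ?_) y z hy hz).trans (mul_le_mul_of_nonneg_right hconst hω.le)
    rw [abs_of_nonneg (hq0 u i)]
    exact hq u i

end RatingModel

theorem mainTheorem2 {K K' L : ℕ}
    (α : Fin K → ℝ) (hα : ∀ k, 0 < α k) (hα_sum : ∑ k, α k = 1)
    (β : Fin K' → ℝ) (hβ : ∀ k', 0 < β k') (hβ_sum : ∑ k', β k' = 1)
    (γ : ℝ) (hγ_pos : 0 < γ) (hγ_lt : γ < 1)
    (R : Matrix (Fin K) (Fin K') ℝ) (hR : ∀ k k', 0 ≤ R k k' ∧ R k k' ≤ 1)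
    (ω : ℕ → ℝ) (hω_top : Tendsto ω atTop atTop)
    (hω_o : ω =o[atTop] fun N : ℕ => (N : ℝ))
    (hL_rank : L ≤ (RatingModel.affinityGram R α β).rank)
    (lam : Fin L → ℝ)
    (h_lam : RatingModel.AreLargestEigenvalues (RatingModel.affinityGram R α β) lam)
    (g : Fin L → Fin K → ℝ)
    (hg_eigen : ∀ l, RatingModel.affinityGram R α β *ᵥ g l = lam l • g l)
    (hg_norm : ∀ l, RatingModel.alphaNorm α (g l) = 1)
    (h_distinct : ∀ k l, k ≠ l → RatingModel.coordRow g k ≠ RatingModel.coordRow g l)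
    (C : ℝ) (hC : 0 < C) (hω_log : ∀ᶠ N : ℕ in atTop, C * Real.log N ≤ ω N) :
    ∃ ε δ η : ℕ → ℝ, Tendsto ε atTop (𝓝 0) ∧ Tendsto δ atTop (𝓝 0) ∧ Tendsto η atTop (𝓝 0) ∧
      ∀ (N F : ℕ), (F : ℝ) = γ * N →
      ∀ (kU : Fin N → Fin K) (kI : Fin F → Fin K'),
        RatingModel.HasClassFractions kU α → RatingModel.HasClassFractions kI β →
      ∀ (Ω : Type*) [MeasurableSpace Ω] (P : Measure Ω) [IsProbabilityMeasure P]
        (S : Ω → Matrix (Fin N) (Fin F) ℝ),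
        RatingModel.IsBernoulliMatrix P S (fun u i => ω N / N * R (kU u) (kI i)) →
        1 - η N ≤ P.real {w | ∀ x : Fin L → Fin N → ℝ,
          RatingModel.AreTopLeftSingularVectors (S w) x →
          ∃ s : Fin L → ℝ, (∀ l, s l = 1 ∨ s l = -1) ∧
            (1 - δ N) * N ≤ ({u : Fin N |
              ‖Real.sqrt N • RatingModel.coordRow (fun l => s l • x l) u -
                RatingModel.coordRow g (kU u)‖ ≤ ε N}.ncard : ℝ)} := by
  obtain ⟨ε, hε, hrec⟩ := RatingModel.exists_seq_of_eventually
    (p := fun N ε => RatingModel.RecoversClasses α β γ R ω g N ε)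
    -- At precision `1` the probability bound reads `0 ≤ P.real _`.
    (fun N F _ kU kI _ _ Ω _ P _ S _ => by simp)
    (fun ε hε => RatingModel.eventually_recoversClasses hα hβ hγ_pos hγ_lt hR hω_top hL_rank h_lam
      hg_eigen hg_norm hC hω_log hε)
  exact ⟨ε, ε, ε, hε, hε, hε, fun N => hrec N⟩
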